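/- Let $E$ be a (real) Banach lattice, let $k$ be a positive integer and let $1\le p<\infty$. A sequence $(x_n)_n$ in $E$ is disjoint if $|x_m|\wedge|x_n|=0$ whenever $m\neq n$, and weakly $p$-summable if $\sum_n|x^*(x_n)|^p<\infty$ for every $x^*\in E^*$. A map from $E$ to a Banach space is disjoint $p$-convergent if it sends disjoint weakly $p$-summable sequences to norm null sequences. $E$ has the disjoint Dunford–Pettis property of order $p$ (disjoint $DPP_p$) if for every disjoint weakly $p$-summable sequence $(x_n)_n$ in $E$, every weakly null sequence in $E^*$ converges to zero uniformly on $\{x_n:n\in\mathbb N\}$. A $k$-homogeneous polynomial $P$ between Banach lattices is positive if its associated symmetric $k$-linear operator takes nonnegative values on $k$-tuples of nonnegative vectors, and it is weakly compact if it maps the closed unit ball onto a relatively weakly compact set. $\mathcal P^r(^kE)$ denotes the Banach lattice of all differences of two positive scalar-valued $k$-homogeneous polynomials on $E$, ordered by the cone of positive polynomials and normed by $\|P\|_r=\||P|\|=\sup_{\|x\|\le 1}\bigl||P|(x)\bigr|$. The following statements are equivalent. (a) $E$ has the disjoint $DPP_p$. (b) For any Banach lattice $F$ with order continuous norm, every positive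 weakly compact $k$-homogeneous polynomial $P\colon E\to F$ is disjoint $p$-convergent. (c) Every positive weakly compact $k$-homogeneous polynomial $P\colon E\to c_0$ is disjoint $p$-convergent. (d) For every disjoint weakly $p$-summable sequence $(x_n)_n$ in $E$ and every positive weakly null sequence $(P_n)_n$ in $\mathcal P^r(^kE)$, $P_n(x_n)\to 0$. (e) For every disjoint weakly $p$-summable sequence $(x_n)_n$ in $E$ and every positive disjoint weakly null sequence $(P_n)_n$ in $\mathcal P^r(^kE)$, $P_n(x_n)\to 0$. (f) For every disjoint weakly $p$-summable sequence $(x_n)_n$ in $E$ and every disjoint weakly null sequence $(P_n)_n$ in $\mathcal P^r(^kE)$, $P_n(x_n)\to 0$. -/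

import Mathlib

open Filter Topology
open scoped ZeroAtInfty

noncomputable section

/-! ### The Banach lattice `c₀ = C₀(ℕ, ℝ)`, with the coordinatewise order -/

section CZero

variable {α : Type*} [TopologicalSpace α]

instance : Max C₀(α, ℝ) where
  max f g :=
    { toFun := fun a => f a ⊔ g a
      continuous_toFun := (map_continuous f).sup (map_continuous g)
      zero_at_infty' := by
        simpa using (zero_at_infty f).sup_nhds (zero_at_infty g) }

instance : Min C₀(α, ℝ) where
  min f g :=
    { toFun := fun a => f a ⊓ g a
      continuous_toFun := (map_continuous f).inf (map_continuous g)
      zero_at_infty' := by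
        simpa using (zero_at_infty f).inf_nhds (zero_at_infty g) }

instance : PartialOrder C₀(α, ℝ) := PartialOrder.lift (fun f => (f : α → ℝ)) DFunLike.coe_injective

instance : Lattice C₀(α, ℝ) :=
  { (inferInstance : PartialOrder C₀(α, ℝ)) with
    sup := fun f g => f ⊔ g
    inf := fun f g => f ⊓ g
    le_sup_left := fun _ _ _ => le_sup_left
    le_sup_right := fun _ _ _ => le_sup_right
    sup_le := fun _ _ _ h₁ h₂ a => sup_le (h₁ a) (h₂ a)
    inf_le_left := fun _ _ _ => inf_le_left
    inf_le_right := fun _ _ _ => inf_le_right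
    le_inf := fun _ _ _ h₁ h₂ a => le_inf (h₁ a) (h₂ a) }

instance : IsOrderedAddMonoid C₀(α, ℝ) where
  add_le_add_left _ _ h c a := by simpa using h a

instance : IsOrderedModule ℝ C₀(α, ℝ) where
  smul_le_smul_of_nonneg_left _ hc _ _ h a := mul_le_mul_of_nonneg_left (h a) hc
  smul_le_smul_of_nonneg_right _ hf _ _ h a := mul_le_mul_of_nonneg_right h (hf a)

instance : HasSolidNorm C₀(α, ℝ) where
  solid f g h := by
    rw [← ZeroAtInftyContinuousMap.norm_toBCF_eq_norm, ← ZeroAtInftyContinuousMap.norm_toBCF_eq_norm]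
    refine (BoundedContinuousFunction.norm_le (norm_nonneg _)).2 fun a => ?_
    exact le_trans (h a) (g.toBCF.norm_coe_le_norm a)

end CZero

/-! ### Sequences in normed spaces and Banach lattices -/

section Sequences

/-- `(v n)` is weakly null in the normed space `V`. -/
def WeaklyNull {V : Type*} [NormedAddCommGroup V] [NormedSpace ℝ V] (v : ℕ → V) : Prop :=
  ∀ φ : V →L[ℝ] ℝ, Tendsto (fun n => φ (v n)) atTop (𝓝 0)

/-- `(x n)` is weakly `p`-summable: `∑ |x*(x n)| ^ p < ∞` for every `x*` in the dual. -/
def WeaklyPSummable {X : Type*} [NormedAddCommGroup X] [NormedSpace ℝ X] (p : ℝ)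
    (x : ℕ → X) : Prop :=
  ∀ f : X →L[ℝ] ℝ, Summable fun n => |f (x n)| ^ p

/-- `(x n)` consists of pairwise disjoint elements of the vector lattice `E`. -/
def DisjointSeq {E : Type*} [AddCommGroup E] [Lattice E] (x : ℕ → E) : Prop :=
  ∀ m n, m ≠ n → |x m| ⊓ |x n| = 0

/-- `A` is a Dunford-Pettis set: weakly null sequences of the dual converge to zero uniformly
on `A`. -/
def IsDunfordPettisSet {X : Type*} [NormedAddCommGroup X] [NormedSpace ℝ X] (A : Set X) : Prop :=
  ∀ f : ℕ → (X →L[ℝ] ℝ), WeaklyNull f → TendstoUniformlyOn (fun n x => f n x) 0 atTop A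

/-- The disjoint Dunford-Pettis property of order `p`. -/
def DisjointDPP (p : ℝ) (E : Type*) [NormedAddCommGroup E] [NormedSpace ℝ E] [Lattice E] : Prop :=
  ∀ x : ℕ → E, DisjointSeq x → WeaklyPSummable p x → IsDunfordPettisSet (Set.range x)

/-- A (not necessarily linear) map is disjoint `p`-convergent if it maps disjoint weakly
`p`-summable sequences to norm null sequences. -/
def DisjointPConvergent (p : ℝ) {E Y : Type*} [NormedAddCommGroup E] [NormedSpace ℝ E] [Lattice E]
    [NormedAddCommGroup Y] (P : E → Y) : Prop :=
  ∀ x : ℕ → E, DisjointSeq x → WeaklyPSummable p x → Tendsto (fun n => P (x n)) atTop (𝓝 0)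

/-- The norm of `F` is order continuous: `x_α ↓ 0` implies `‖x_α‖ → 0`. (The norm is monotone on
the positive cone, so decreasing nets may be replaced with downward directed sets.) -/
def OrderContinuousNorm (F : Type*) [NormedAddCommGroup F] [Lattice F] : Prop :=
  ∀ D : Set F, D.Nonempty → DirectedOn (· ≥ ·) D → IsGLB D 0 → ∀ ε > 0, ∃ x ∈ D, ‖x‖ < ε

/-- A map between normed spaces is weakly compact if the image of the closed unit ball is
relatively compact in the weak topology. -/
def WeaklyCompactMap {X Y : Type*} [NormedAddCommGroup X] [NormedAddCommGroup Y] [NormedSpace ℝ Y]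
    (P : X → Y) : Prop :=
  IsCompact (closure (toWeakSpace ℝ Y '' (P '' Metric.closedBall 0 1)))

end Sequences

/-! ### Positive and regular homogeneous polynomials -/

section Polynomials

/-- `P` is a positive `k`-homogeneous polynomial: `P x = T (x, …, x)` where `T`, the (unique)
symmetric `k`-linear map associated with `P`, is positive. As usual polynomials between normed
spaces are continuous; on Banach lattices positivity implies this. -/
def IsPosHomPoly (k : ℕ) {E F : Type*} [NormedAddCommGroup E] [NormedSpace ℝ E] [PartialOrder E]
    [NormedAddCommGroup F] [NormedSpace ℝ F] [PartialOrder F] (P : E → F) : Prop :=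
  ∃ T : ContinuousMultilinearMap ℝ (fun _ : Fin k => E) F,
    (∀ (σ : Equiv.Perm (Fin k)) (v : Fin k → E), T (fun i => v (σ i)) = T v) ∧
    (∀ v : Fin k → E, (∀ i, 0 ≤ v i) → 0 ≤ T v) ∧
    ∀ x, P x = T (fun _ => x)

variable {k : ℕ} {E : Type*} [NormedAddCommGroup E] [NormedSpace ℝ E] [Lattice E]

theorem IsPosHomPoly.zero : IsPosHomPoly k (0 : E → ℝ) :=
  ⟨0, by simp, by simp, by simp⟩

theorem IsPosHomPoly.add {P Q : E → ℝ} (hP : IsPosHomPoly k P) (hQ : IsPosHomPoly k Q) :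
    IsPosHomPoly k (P + Q) := by
  obtain ⟨T, hT, hT', hP⟩ := hP
  obtain ⟨S, hS, hS', hQ⟩ := hQ
  refine ⟨T + S, fun σ v => ?_, fun v hv => ?_, fun x => ?_⟩
  · simp [hT σ v, hS σ v]
  · simpa using add_nonneg (hT' v hv) (hS' v hv)
  · simp [hP, hQ]

theorem IsPosHomPoly.smul {P : E → ℝ} (hP : IsPosHomPoly k P) {c : ℝ} (hc : 0 ≤ c) :
    IsPosHomPoly k (c • P) := by
  obtain ⟨T, hT, hT', hP⟩ := hP
  refine ⟨c • T, fun σ v => ?_, fun v hv => ?_, fun x => ?_⟩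
  · simp [hT σ v]
  · simpa using mul_nonneg hc (hT' v hv)
  · simp [hP]

theorem abs_map_le_map_abs [IsOrderedAddMonoid E]
    (T : ContinuousMultilinearMap ℝ (fun _ : Fin k => E) ℝ)
    (hT : ∀ v : Fin k → E, (∀ i, 0 ≤ v i) → 0 ≤ T v) (v : Fin k → E) :
    |T v| ≤ T (fun i => |v i|) := by
  suffices H : ∀ (s : Finset (Fin k)) (w : Fin k → E), (∀ i, i ∉ s → 0 ≤ w i) →
      |T w| ≤ T (fun i => |w i|) from H Finset.univ v (by simp)
  intro s
  induction s using Finset.induction_on with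
  | empty =>
    intro w hw
    have h : (fun i => |w i|) = w := funext fun i => abs_of_nonneg (hw i (by simp))
    rw [h, abs_of_nonneg (hT w fun i => hw i (by simp))]
  | insert a s _ ih =>
    intro w hw
    have key : ∀ y : E, 0 ≤ y →
        |T (Function.update w a y)| ≤ T (Function.update (fun i => |w i|) a y) := by
      intro y hy
      have h := ih (Function.update w a y) (fun i hi => by
        by_cases h : i = a
        · subst h; simpa using hy
        · simpa [h] using hw i (by simp [h, hi]))
      have h' : (fun i => |Function.update w a y i|) = Function.update (fun i => |w i|) a y := by
        funext i
        by_cases h : i = a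
        · subst h; simpa using abs_of_nonneg hy
        · simp [h]
      rwa [h'] at h
    have e₁ : T w = T (Function.update w a (w a)⁺) - T (Function.update w a (w a)⁻) := by
      rw [← ContinuousMultilinearMap.map_update_sub, posPart_sub_negPart, Function.update_eq_self]
    have e₂ : T (fun i => |w i|) = T (Function.update (fun i => |w i|) a (w a)⁺)
        + T (Function.update (fun i => |w i|) a (w a)⁻) := by
      rw [← ContinuousMultilinearMap.map_update_add, posPart_add_negPart]
      congr 1
      exact (Function.update_eq_self a (fun i => |w i|)).symm
    rw [e₁, e₂]
    exact (abs_sub _ _).trans (add_le_add (key _ (posPart_nonneg _)) (key _ (negPart_nonneg _)))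

theorem IsPosHomPoly.nonneg {P : E → ℝ} (hP : IsPosHomPoly k P) {x : E} (hx : 0 ≤ x) :
    0 ≤ P x := by
  obtain ⟨T, _, hT', hP⟩ := hP
  rw [hP]
  exact hT' _ fun _ => hx

theorem IsPosHomPoly.abs_le [IsOrderedAddMonoid E] {P : E → ℝ} (hP : IsPosHomPoly k P) (x : E) :
    |P x| ≤ P |x| := by
  obtain ⟨T, _, hT', hP⟩ := hP
  rw [hP, hP]
  exact abs_map_le_map_abs T hT' _

variable (k E) in
/-- The vector space of regular scalar valued `k`-homogeneous polynomials on `E`: the differences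
of two positive ones. -/
def regularPolynomials : Submodule ℝ (E → ℝ) where
  carrier := {P | ∃ P₁ P₂ : E → ℝ, IsPosHomPoly k P₁ ∧ IsPosHomPoly k P₂ ∧ P = P₁ - P₂}
  zero_mem' := ⟨0, 0, .zero, .zero, by simp⟩
  add_mem' := by
    rintro _ _ ⟨P₁, P₂, h₁, h₂, rfl⟩ ⟨Q₁, Q₂, g₁, g₂, rfl⟩
    exact ⟨_, _, h₁.add g₁, h₂.add g₂, by abel⟩
  smul_mem' := by
    rintro c _ ⟨P₁, P₂, h₁, h₂, rfl⟩
    rcases le_total 0 c with hc | hc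
    · exact ⟨_, _, h₁.smul hc, h₂.smul hc, smul_sub _ _ _⟩
    · have hc : 0 ≤ -c := neg_nonneg.2 hc
      exact ⟨_, _, h₂.smul hc, h₁.smul hc, by module⟩

variable (k E) in
/-- The space `𝒫ʳ(ᵏE)` of regular scalar valued `k`-homogeneous polynomials on `E`. It carries the
order given by the positive polynomials (not the pointwise order) and the regular norm. -/
def RegPoly : Type _ := ↥(regularPolynomials k E)

namespace RegPoly

instance : AddCommGroup (RegPoly k E) := inferInstanceAs (AddCommGroup ↥(regularPolynomials k E))

instance : Module ℝ (RegPoly k E) := inferInstanceAs (Module ℝ ↥(regularPolynomials k E))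

instance : FunLike (RegPoly k E) E ℝ where
  coe := fun P : ↥(regularPolynomials k E) => (P : E → ℝ)
  coe_injective := fun _ _ h => Subtype.ext h

@[ext]
theorem ext {P Q : RegPoly k E} (h : ∀ x, P x = Q x) : P = Q := DFunLike.ext _ _ h

@[simp]
theorem zero_apply (x : E) : (0 : RegPoly k E) x = 0 := rfl

@[simp]
theorem add_apply (P Q : RegPoly k E) (x : E) : (P + Q) x = P x + Q x := rfl

@[simp]
theorem sub_apply (P Q : RegPoly k E) (x : E) : (P - Q) x = P x - Q x := rfl

@[simp]
theorem neg_apply (P : RegPoly k E) (x : E) : (-P) x = -P x := rfl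

@[simp]
theorem smul_apply (c : ℝ) (P : RegPoly k E) (x : E) : (c • P) x = c * P x := rfl

theorem exists_eq_sub (P : RegPoly k E) : ∃ P₁ P₂ : E → ℝ, IsPosHomPoly k P₁ ∧ IsPosHomPoly k P₂ ∧
    ∀ x, P x = P₁ x - P₂ x := by
  obtain ⟨P₁, P₂, h₁, h₂, h⟩ := Subtype.property (p := (· ∈ regularPolynomials k E)) P
  exact ⟨P₁, P₂, h₁, h₂, fun x => congrFun h x⟩

/-- A positive `k`-homogeneous polynomial as an element of `𝒫ʳ(ᵏE)`. -/
def ofPos {P : E → ℝ} (hP : IsPosHomPoly k P) : RegPoly k E :=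
  Subtype.mk (p := (· ∈ regularPolynomials k E)) P ⟨P, 0, hP, .zero, by simp⟩

@[simp]
theorem ofPos_apply {P : E → ℝ} (hP : IsPosHomPoly k P) (x : E) : ofPos hP x = P x := rfl

/-- The supremum norm of `P` on the closed unit ball. -/
def supNorm (P : RegPoly k E) : ℝ := ⨆ x : Metric.closedBall (0 : E) 1, |P x|

theorem bddAbove (P : RegPoly k E) :
    BddAbove (Set.range fun x : Metric.closedBall (0 : E) 1 => |P x|) := by
  obtain ⟨P₁, P₂, ⟨T, _, _, hT⟩, ⟨S, _, _, hS⟩, hP⟩ := P.exists_eq_sub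
  have bd : ∀ (R : ContinuousMultilinearMap ℝ (fun _ : Fin k => E) ℝ) (x : E), ‖x‖ ≤ 1 →
      |R fun _ => x| ≤ ‖R‖ := by
    intro R x hx
    refine (R.le_opNorm _).trans ?_
    simpa using mul_le_of_le_one_right (norm_nonneg R) (pow_le_one₀ (norm_nonneg x) hx)
  refine ⟨‖T‖ + ‖S‖, ?_⟩
  rintro _ ⟨⟨x, hx⟩, rfl⟩
  have hx : ‖x‖ ≤ 1 := by simpa using hx
  change |P x| ≤ _
  rw [hP, hT, hS]
  exact (abs_sub _ _).trans (add_le_add (bd T x hx) (bd S x hx))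

theorem abs_apply_le_supNorm (P : RegPoly k E) {x : E} (hx : ‖x‖ ≤ 1) : |P x| ≤ P.supNorm :=
  le_ciSup P.bddAbove ⟨x, by simpa using hx⟩

theorem supNorm_le {P : RegPoly k E} {C : ℝ} (h : ∀ x, ‖x‖ ≤ 1 → |P x| ≤ C) : P.supNorm ≤ C :=
  haveI : Nonempty (Metric.closedBall (0 : E) 1) := ⟨⟨0, by simp⟩⟩
  ciSup_le fun x => h x (mem_closedBall_zero_iff.1 x.2)

theorem supNorm_nonneg (P : RegPoly k E) : 0 ≤ P.supNorm :=
  (abs_nonneg _).trans (P.abs_apply_le_supNorm (x := 0) (by simp))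

theorem map_smul_self (P : RegPoly k E) (c : ℝ) (x : E) : P (c • x) = c ^ k * P x := by
  obtain ⟨P₁, P₂, ⟨T, _, _, hT⟩, ⟨S, _, _, hS⟩, hP⟩ := P.exists_eq_sub
  have h : ∀ R : ContinuousMultilinearMap ℝ (fun _ : Fin k => E) ℝ,
      (R fun _ => c • x) = c ^ k * R fun _ => x := fun R => by
    simpa using R.map_smul_univ (fun _ => c) (fun _ => x)
  rw [hP, hP, hT, hT, hS, hS, h, h]
  ring

variable [IsOrderedAddMonoid E]

/-- `P ≤ Q` means that the polynomial `Q - P` is positive. -/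
instance : PartialOrder (RegPoly k E) where
  le P Q := IsPosHomPoly k (fun x => Q x - P x)
  le_refl P := by
    convert! IsPosHomPoly.zero (k := k) (E := E) using 1
    funext x; simp
  le_trans P Q R h₁ h₂ := by
    convert! IsPosHomPoly.add h₁ h₂ using 1
    funext x; simp
  le_antisymm P Q h₁ h₂ := by
    ext x
    have a := h₁.nonneg (abs_nonneg x)
    have b := h₂.nonneg (abs_nonneg x)
    have c := h₁.abs_le x
    have d : |Q x - P x| ≤ 0 := by linarith
    have := abs_nonpos_iff.1 d
    linarith

theorem le_iff {P Q : RegPoly k E} : P ≤ Q ↔ IsPosHomPoly k (fun x => Q x - P x) := Iff.rfl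

instance : IsOrderedAddMonoid (RegPoly k E) where
  add_le_add_left P Q h R := by
    rw [le_iff] at h ⊢
    simpa using h

theorem smul_le_smul' {P Q : RegPoly k E} (h : P ≤ Q) {c : ℝ} (hc : 0 ≤ c) : c • P ≤ c • Q := by
  rw [le_iff] at h ⊢
  convert! h.smul hc using 1
  funext x
  simp [mul_sub]

theorem abs_apply_le_of_le {P Q : RegPoly k E} (h₁ : -Q ≤ P) (h₂ : P ≤ Q) (x : E) :
    |P x| ≤ Q |x| := by
  have a := IsPosHomPoly.abs_le (le_iff.1 h₁) x
  have b := IsPosHomPoly.abs_le (le_iff.1 h₂) x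
  simp only [neg_apply, sub_neg_eq_add] at a b
  have e : P x = ((P x + Q x) - (Q x - P x)) / 2 := by ring
  rw [e, abs_div, abs_two, div_le_iff₀ two_pos]
  calc _ ≤ |P x + Q x| + |Q x - P x| := abs_sub _ _
    _ ≤ _ := by linarith

/-- `A` is the absolute value `|P| = P ∨ (-P)` of `P` in the lattice `𝒫ʳ(ᵏE)`. -/
def IsAbs (P A : RegPoly k E) : Prop := IsLUB {P, -P} A

/-- `(P n)` is a disjoint sequence of `𝒫ʳ(ᵏE)`: `|P m| ∧ |P n| = 0` for `m ≠ n`. -/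
def DisjointSeq (P : ℕ → RegPoly k E) : Prop :=
  ∀ m n, m ≠ n → ∃ A B, IsAbs (P m) A ∧ IsAbs (P n) B ∧ IsGLB {A, B} 0

/-- The regular norm `‖P‖ᵣ = inf {‖Q‖ : -Q ≤ P ≤ Q}`; the infimum is attained at `Q = |P|`, see
`RegPoly.norm_eq_of_isAbs`. -/
def regNorm (P : RegPoly k E) : ℝ := sInf {r | ∃ Q : RegPoly k E, -Q ≤ P ∧ P ≤ Q ∧ r = Q.supNorm}

theorem regNorm_nonneg (P : RegPoly k E) : 0 ≤ P.regNorm := by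
  apply Real.sInf_nonneg
  rintro _ ⟨Q, _, _, rfl⟩
  exact Q.supNorm_nonneg

theorem regNorm_le {P Q : RegPoly k E} (h₁ : -Q ≤ P) (h₂ : P ≤ Q) : P.regNorm ≤ Q.supNorm := by
  refine csInf_le ⟨0, ?_⟩ ⟨Q, h₁, h₂, rfl⟩
  rintro _ ⟨Q, _, _, rfl⟩
  exact Q.supNorm_nonneg

theorem exists_dominating (P : RegPoly k E) : ∃ Q : RegPoly k E, -Q ≤ P ∧ P ≤ Q := by
  obtain ⟨P₁, P₂, h₁, h₂, hP⟩ := P.exists_eq_sub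
  refine ⟨ofPos (h₁.add h₂), ?_, ?_⟩
  · rw [le_iff]
    convert! h₁.add h₁ using 1
    funext x
    simp only [neg_apply, ofPos_apply, hP, Pi.add_apply]
    ring
  · rw [le_iff]
    convert! h₂.add h₂ using 1
    funext x
    simp only [ofPos_apply, hP, Pi.add_apply]
    ring

theorem le_regNorm {P : RegPoly k E} {C : ℝ}
    (h : ∀ Q : RegPoly k E, -Q ≤ P → P ≤ Q → C ≤ Q.supNorm) : C ≤ P.regNorm := by
  obtain ⟨Q, h₁, h₂⟩ := P.exists_dominating
  refine le_csInf ⟨_, Q, h₁, h₂, rfl⟩ ?_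
  rintro _ ⟨Q, h₁, h₂, rfl⟩
  exact h Q h₁ h₂

theorem regNorm_add_le (P Q : RegPoly k E) : (P + Q).regNorm ≤ P.regNorm + Q.regNorm := by
  rw [← sub_le_iff_le_add]
  refine le_regNorm fun A a₁ a₂ => ?_
  rw [sub_le_comm]
  refine le_regNorm fun B b₁ b₂ => ?_
  rw [sub_le_iff_le_add']
  refine (regNorm_le (Q := A + B) ?_ (add_le_add a₂ b₂)).trans (supNorm_le fun x hx => ?_)
  · rw [neg_add]
    exact add_le_add a₁ b₁
  · exact (abs_add_le _ _).trans
      (add_le_add (A.abs_apply_le_supNorm hx) (B.abs_apply_le_supNorm hx))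

theorem regNorm_smul_le (c : ℝ) (P : RegPoly k E) : (c • P).regNorm ≤ |c| * P.regNorm := by
  have key : ∀ Q : RegPoly k E, -Q ≤ P → P ≤ Q → (c • P).regNorm ≤ |c| * Q.supNorm := by
    intro Q h₁ h₂
    have h : -(|c| • Q) ≤ c • P ∧ c • P ≤ |c| • Q := by
      rcases le_total 0 c with hc | hc
      · rw [abs_of_nonneg hc, ← smul_neg]
        exact ⟨smul_le_smul' h₁ hc, smul_le_smul' h₂ hc⟩
      · have hc' : 0 ≤ -c := neg_nonneg.2 hc
        rw [abs_of_nonpos hc]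
        have a := smul_le_smul' h₁ hc'
        have b := smul_le_smul' h₂ hc'
        simp only [neg_smul, smul_neg, neg_neg] at a b ⊢
        exact ⟨by simpa using neg_le_neg b, by simpa using neg_le_neg a⟩
    refine (regNorm_le h.1 h.2).trans (supNorm_le fun x hx => ?_)
    rw [smul_apply, abs_mul, abs_abs]
    exact mul_le_mul_of_nonneg_left (Q.abs_apply_le_supNorm hx) (abs_nonneg c)
  rcases eq_or_ne c 0 with rfl | hc
  · obtain ⟨Q, h₁, h₂⟩ := P.exists_dominating
    simpa using key Q h₁ h₂
  · have hc : 0 < |c| := abs_pos.2 hc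
    rw [← div_le_iff₀' hc]
    exact le_regNorm fun Q h₁ h₂ => (div_le_iff₀' hc).2 (key Q h₁ h₂)

theorem regNorm_smul (c : ℝ) (P : RegPoly k E) : (c • P).regNorm = |c| * P.regNorm := by
  refine le_antisymm (regNorm_smul_le c P) ?_
  rcases eq_or_ne c 0 with rfl | hc
  · simpa using regNorm_nonneg _
  · have h := regNorm_smul_le c⁻¹ (c • P)
    rwa [smul_smul, inv_mul_cancel₀ hc, one_smul, abs_inv,
      le_inv_mul_iff₀ (abs_pos.2 hc)] at h

variable [HasSolidNorm E]

theorem abs_apply_le_regNorm (P : RegPoly k E) {x : E} (hx : ‖x‖ ≤ 1) : |P x| ≤ P.regNorm :=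
  le_regNorm fun Q h₁ h₂ => (abs_apply_le_of_le h₁ h₂ x).trans <|
    (le_abs_self _).trans <| Q.abs_apply_le_supNorm (by rwa [norm_abs_eq_norm])

/-- The regular norm. -/
instance : Norm (RegPoly k E) := ⟨regNorm⟩

theorem normCore : NormedSpace.Core ℝ (RegPoly k E) where
  norm_nonneg := regNorm_nonneg
  norm_smul := regNorm_smul
  norm_triangle := regNorm_add_le
  norm_eq_zero_iff P := by
    constructor
    · intro h
      change P.regNorm = 0 at h
      have h0 : ∀ x : E, ‖x‖ ≤ 1 → P x = 0 := fun x hx =>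
        abs_nonpos_iff.1 (h ▸ P.abs_apply_le_regNorm hx)
      ext x
      have hpos : 0 < ‖x‖ + 1 := by positivity
      have hx : x = (‖x‖ + 1) • ((‖x‖ + 1)⁻¹ • x) := by
        rw [smul_smul, mul_inv_cancel₀ hpos.ne', one_smul]
      rw [hx, map_smul_self, h0, mul_zero, zero_apply]
      rw [norm_smul, norm_inv, Real.norm_of_nonneg hpos.le, inv_mul_le_iff₀ hpos]
      linarith
    · rintro rfl
      change (0 : RegPoly k E).regNorm = 0
      simpa using regNorm_smul 0 (0 : RegPoly k E)

instance : NormedAddCommGroup (RegPoly k E) := NormedAddCommGroup.ofCore normCore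

instance : NormedSpace ℝ (RegPoly k E) := NormedSpace.ofCore normCore

/-- The regular norm of `P` is the supremum norm of `|P|`. -/
theorem norm_eq_of_isAbs {P A : RegPoly k E} (h : IsAbs P A) : ‖P‖ = A.supNorm := by
  have h₂ : P ≤ A := h.1 (by simp)
  have h₁ : -P ≤ A := h.1 (by simp)
  have h₁' : -A ≤ P := by simpa using neg_le_neg h₁
  refine le_antisymm (regNorm_le h₁' h₂) (le_regNorm fun Q q₁ q₂ => ?_)
  have hAQ : A ≤ Q := h.2 (by
    rintro R (rfl | rfl)
    · exact q₂
    · simpa using neg_le_neg q₁)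
  have hA : -A ≤ A := h₁'.trans h₂
  refine supNorm_le fun x hx => (abs_apply_le_of_le hA le_rfl x).trans ?_
  have := IsPosHomPoly.nonneg (le_iff.1 hAQ) (abs_nonneg x)
  have hb := (le_abs_self (Q |x|)).trans (Q.abs_apply_le_supNorm (by rwa [norm_abs_eq_norm]))
  linarith

end RegPoly

end Polynomials

end

/-! The Dunford–Pettis property passes to `k`-linear forms by induction on `k`: extend one variable
to the bidual by Goldstine's theorem, which replaces `Aₙ` by the `(k - 1)`-linear forms
`φ ∘ (Aₙ).curryRight` with values in the same compact set of null sequences. Applied to the forms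
of a weakly null sequence of polynomials this gives `Pₙ xₙ → 0`. For a weakly compact polynomial
with symmetric operator `T`, norm `T (xₙ, …, xₙ)` by functionals `fₙ`; polarization puts `T` of the
unit ball into a weakly compact set, on which a subsequence of `(fₙ)` converges pointwise.

Conversely, by the Schur property of `ℓ¹`, for disjoint `(xₙ)` and weakly null `(fₙ)` the moduli
`gₙ` of `fₙ` on the bands generated by the `xₙ` form a weakly null disjoint sequence of positive
functionals with `|fₙ xₙ| ≤ gₙ |xₙ|`. The powers `gₙᵏ` inherit these properties, so `gₙ |xₙ| → 0`
if disjoint positive weakly null sequences of polynomials tend to zero along `(|xₙ|)`.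

Finally, a weakly null sequence of positive polynomials gives a positive polynomial `x ↦ (Pₙ x)ₙ`
into `c₀`. It is weakly compact because it factors through the operator `φ ↦ (φ Pₙ)ₙ` on the dual
of `𝒫ʳ(ᵏE)`, which is continuous from the weak* to the weak topology on bounded sets. -/

noncomputable section

section FunctionalAnalysis

variable {X : Type*} [NormedAddCommGroup X] [NormedSpace ℝ X]

theorem goldstine {φ : (X →L[ℝ] ℝ) →L[ℝ] ℝ} (hφ : ‖φ‖ ≤ 1) :
    StrongDual.toWeakDual φ ∈ closure ((fun y => StrongDual.toWeakDual
      (NormedSpace.inclusionInDoubleDual ℝ X y)) '' Metric.closedBall 0 1) := by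
  by_contra hmem
  have hconv := (convex_closedBall (0 : X) 1).linear_image
    (StrongDual.toWeakDual.toLinearMap ∘ₗ (NormedSpace.inclusionInDoubleDual ℝ X).toLinearMap)
  have : LocallyConvexSpace ℝ (WeakDual ℝ (X →L[ℝ] ℝ)) :=
    (WeakDual.withSeminorms ℝ _).toLocallyConvexSpace
  obtain ⟨L, u, hL, hu⟩ := geometric_hahn_banach_closed_point hconv.closure isClosed_closure hmem
  obtain ⟨G, rfl⟩ := LinearMap.dualEmbedding_surjective _ L
  have hball : ∀ y : X, ‖y‖ ≤ 1 → G y < u := fun y hy =>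
    hL _ (subset_closure ⟨y, mem_closedBall_zero_iff.2 hy, rfl⟩)
  have hu0 : 0 < u := by simpa using hball 0 (by simp)
  have hG : ‖G‖ ≤ u := ContinuousLinearMap.opNorm_le_of_unit_norm hu0.le fun y hy =>
    abs_le.2 ⟨by linarith [hball (-y) (by simp [hy]), G.map_neg y], (hball y hy.le).le⟩
  have hφG : φ G ≤ ‖G‖ := by simpa using (le_abs_self _).trans (φ.le_of_opNorm_le hφ G)
  exact hu.not_ge (hφG.trans hG)

theorem exists_ultrafilter_tendsto_bidual {φ : (X →L[ℝ] ℝ) →L[ℝ] ℝ} (hφ : ‖φ‖ ≤ 1) :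
    ∃ U : Ultrafilter X, (∀ᶠ y in (U : Filter X), ‖y‖ ≤ 1) ∧
      ∀ h : X →L[ℝ] ℝ, Tendsto (fun y => h y) U (𝓝 (φ h)) := by
  have hcluster := goldstine hφ
  rw [mem_closure_iff_clusterPt, ← map_principal] at hcluster
  obtain ⟨U, hU, hUφ⟩ := mapClusterPt_iff_ultrafilter.1 hcluster
  refine ⟨U, ?_, fun h => ((WeakDual.eval_continuous h).tendsto _).comp hUφ⟩
  filter_upwards [le_principal_iff.1 hU] with y hy using mem_closedBall_zero_iff.1 hy

theorem bidual_apply_mem_of_isClosed {ι : Type*} {C : Set (ι → ℝ)} (hC : IsClosed C)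
    {h : ι → X →L[ℝ] ℝ} (hh : ∀ y : X, ‖y‖ ≤ 1 → (fun i => h i y) ∈ C)
    {φ : (X →L[ℝ] ℝ) →L[ℝ] ℝ} (hφ : ‖φ‖ ≤ 1) : (fun i => φ (h i)) ∈ C := by
  obtain ⟨U, hU, hUφ⟩ := exists_ultrafilter_tendsto_bidual hφ
  exact hC.mem_of_tendsto (tendsto_pi_nhds.2 fun i => hUφ (h i)) (hU.mono hh)

theorem exists_bidual_tendsto {Y : Type*} (U : Ultrafilter Y) {z : Y → X} {C : ℝ}
    (hz : ∀ᶠ y in (U : Filter Y), ‖z y‖ ≤ C) :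
    ∃ ψ : (X →L[ℝ] ℝ) →L[ℝ] ℝ, ∀ h : X →L[ℝ] ℝ, Tendsto (fun y => h (z y)) U (𝓝 (ψ h)) := by
  let J : Y → WeakDual ℝ (X →L[ℝ] ℝ) := fun y =>
    StrongDual.toWeakDual (NormedSpace.inclusionInDoubleDual ℝ X (z y))
  obtain ⟨ψ, -, hψ⟩ := (WeakDual.isCompact_closedBall (𝕜 := ℝ) 0 C).ultrafilter_le_nhds'
    (U.map J) (hz.mono fun y hy => by
      simpa [J] using (NormedSpace.double_dual_bound ℝ X (z y)).trans hy)
  exact ⟨WeakDual.toStrongDual ψ, fun h => ((WeakDual.eval_continuous h).tendsto ψ).comp hψ⟩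

theorem weaklyNull_of_norm_le_one {v : ℕ → X}
    (h : ∀ φ : X →L[ℝ] ℝ, ‖φ‖ ≤ 1 → Tendsto (fun n => φ (v n)) atTop (𝓝 0)) : WeaklyNull v := by
  intro φ
  have hpos : 0 < ‖φ‖ + 1 := by positivity
  have hunit : ‖(‖φ‖ + 1)⁻¹ • φ‖ ≤ 1 := by
    rw [norm_smul, norm_inv, Real.norm_of_nonneg hpos.le, inv_mul_le_iff₀ hpos]
    linarith
  simpa [mul_inv_cancel_left₀ hpos.ne'] using (h _ hunit).const_mul (‖φ‖ + 1)

theorem WeaklyNull.comp_tendsto {v : ℕ → X} (hv : WeaklyNull v) {s : ℕ → ℕ}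
    (hs : Tendsto s atTop atTop) : WeaklyNull (v ∘ s) :=
  fun φ => (hv φ).comp hs

theorem WeaklyNull.exists_norm_le {v : ℕ → X} (hv : WeaklyNull v) : ∃ M, ∀ n, ‖v n‖ ≤ M := by
  obtain ⟨M, hM⟩ := banach_steinhaus (g := fun n => NormedSpace.inclusionInDoubleDual ℝ X (v n))
    fun φ => by
      obtain ⟨C, hC⟩ := (hv φ).norm.bddAbove_range
      exact ⟨C, fun n => hC ⟨n, rfl⟩⟩
  exact ⟨M, fun n => ((NormedSpace.inclusionInDoubleDualLi ℝ).norm_map (v n)).ge.trans (hM n)⟩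

theorem exists_separable_submodule_of_isCompact {K : Set (WeakSpace ℝ X)} (hK : IsCompact K)
    (f : ℕ → X →L[ℝ] ℝ) : ∃ Y : Submodule ℝ X, TopologicalSpace.SeparableSpace Y ∧
      ∀ z ∈ K, ∃ y : Y, ∀ n, f n y = f n ((toWeakSpace ℝ X).symm z) := by
  let e : WeakSpace ℝ X → ℕ → ℝ := fun z n => f n ((toWeakSpace ℝ X).symm z)
  have he : Continuous e := continuous_pi fun n => WeakBilin.eval_continuous _ (f n)
  obtain ⟨D', hD'K, hD'c, hD'⟩ :=
    (TopologicalSpace.IsSeparable.of_separableSpace (e '' K)).exists_countable_dense_subset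
  obtain ⟨D, hDK, hDinj, rfl⟩ := Set.SurjOn.exists_subset_injOn_image_eq hD'K
  have hDc : D.Countable := Set.countable_of_injective_of_countable_image hDinj hD'c
  let Y := (Submodule.span ℝ ((toWeakSpace ℝ X).symm '' D)).topologicalClosure
  have hYsep : TopologicalSpace.IsSeparable (Y : Set X) :=
    (hDc.image _).isSeparable.span.closure
  have hYclosed : IsClosed (toWeakSpace ℝ X '' Y) := by
    refine isClosed_of_closure_subset ?_
    rw [← Y.convex.toWeakSpace_closure ℝ, Submodule.isClosed_topologicalClosure _ |>.closure_eq]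
  have himage : e '' K ⊆ e '' (K ∩ toWeakSpace ℝ X '' Y) :=
    hD'.trans <| closure_minimal (Set.image_mono fun d hd => ⟨hDK hd, _,
      subset_closure (Submodule.subset_span ⟨d, hd, rfl⟩), by simp⟩)
      ((hK.inter_right hYclosed).image he).isClosed
  refine ⟨Y, hYsep.separableSpace, fun z hz => ?_⟩
  obtain ⟨_, ⟨-, y, hy, rfl⟩, hyz⟩ := himage ⟨z, hz, rfl⟩
  exact ⟨⟨y, hy⟩, fun n => congrFun hyz n⟩

theorem exists_subseq_tendsto_on_isCompact {K : Set (WeakSpace ℝ X)} (hK : IsCompact K)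
    {f : ℕ → X →L[ℝ] ℝ} {C : ℝ} (hf : ∀ n, ‖f n‖ ≤ C) :
    ∃ (s : ℕ → ℕ) (g : X →L[ℝ] ℝ), StrictMono s ∧ ∀ z, toWeakSpace ℝ X z ∈ K →
      Tendsto (fun n => f (s n) z) atTop (𝓝 (g z)) := by
  obtain ⟨Y, hY, hYK⟩ := exists_separable_submodule_of_isCompact hK f
  obtain ⟨γ, -, s, hs, hγ⟩ := WeakDual.isSeqCompact_closedBall ℝ Y 0 C
    (x := fun n => StrongDual.toWeakDual ((f n).comp Y.subtypeL)) fun n => by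
      simpa using ((f n).opNorm_comp_le _).trans
        ((mul_le_of_le_one_right (norm_nonneg _) Y.norm_subtypeL_le).trans (hf n))
  obtain ⟨g, -, hg⟩ := (WeakDual.isCompact_closedBall (𝕜 := ℝ) (E := X) 0 C).exists_mapClusterPt
    (f := atTop) (u := fun n : ℕ => StrongDual.toWeakDual (f (s n)))
    (tendsto_principal.2 (Eventually.of_forall fun n => by simpa using hf (s n)))
  refine ⟨s, WeakDual.toStrongDual g, hs, fun z hz => ?_⟩
  obtain ⟨y, hy⟩ := hYK _ hz
  have hlim : Tendsto (fun n => f (s n) z) atTop (𝓝 (γ y)) := by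
    have : (fun n => f (s n) z) = fun n => f (s n) y := by simp [hy]
    rw [this]
    exact (WeakDual.eval_continuous y).continuousAt.tendsto.comp hγ
  have hcluster : MapClusterPt (g z) atTop fun n => f (s n) z :=
    hg.continuousAt_comp (WeakDual.eval_continuous z).continuousAt
  obtain ⟨U, hU, hUg⟩ := mapClusterPt_iff_ultrafilter.1 hcluster
  rwa [WeakDual.coe_toStrongDual, tendsto_nhds_unique hUg (hlim.mono_left hU)]

theorem weaklyNull_of_eventually_lt {v : ℕ → X}
    (h : ∀ (φ : X →L[ℝ] ℝ), ∀ ε > 0, ∀ᶠ n in atTop, φ (v n) < ε) : WeaklyNull v := by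
  refine fun φ => tendsto_order.2 ⟨fun b hb => ?_, h φ⟩
  filter_upwards [h (-φ) (-b) (neg_pos.2 hb)] with n hn
  simpa using hn

theorem WeaklyNull.exists_convex_combination_norm_lt {v : ℕ → X} (hv : WeaklyNull v)
    {q : ℕ → Prop} (hq : ∃ᶠ n in atTop, q n) {δ : ℝ} (hδ : 0 < δ) :
    ∃ (s : Finset ℕ) (a : ℕ → ℝ), (∀ i ∈ s, q i ∧ 0 ≤ a i) ∧ ∑ i ∈ s, a i = 1 ∧
      ‖∑ i ∈ s, a i • v i‖ < δ := by
  let u : Subtype q → X := fun i => v i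
  have h0 : (0 : X) ∈ closure (convexHull ℝ (Set.range u)) := by
    by_contra h
    obtain ⟨L, c, hc, hL⟩ := geometric_hahn_banach_point_closed
      (convex_convexHull ℝ (Set.range u)).closure isClosed_closure h
    rw [map_zero] at hc
    obtain ⟨n, hn, hlt⟩ := (hq.and_eventually ((hv L).eventually_lt_const hc)).exists
    exact hlt.not_gt (hL _ (subset_closure (subset_convexHull _ _ ⟨⟨n, hn⟩, rfl⟩)))
  obtain ⟨w, hw, hwδ⟩ := Metric.mem_closure_iff.1 h0 δ hδ
  rw [convexHull_range_eq_exists_affineCombination] at hw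
  obtain ⟨s, a, ha, ha1, rfl⟩ := hw
  rw [dist_zero_left, Finset.affineCombination_eq_linear_combination _ _ _ ha1] at hwδ
  have hext : ∀ i : Subtype q, Function.extend Subtype.val a 0 i = a i :=
    Subtype.val_injective.extend_apply a 0
  refine ⟨s.map (.subtype q), Function.extend Subtype.val a 0, ?_, ?_, ?_⟩
  · simp only [Finset.forall_mem_map, Function.Embedding.coe_subtype, hext]
    exact fun i hi => ⟨i.2, ha i hi⟩
  · simpa only [Finset.sum_map, Function.Embedding.coe_subtype, hext] using ha1
  · simpa only [Finset.sum_map, Function.Embedding.coe_subtype, hext] using hwδ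

theorem WeaklyNull.of_norm_sum_smul_le {Y : Type*} [NormedAddCommGroup Y] [NormedSpace ℝ Y]
    {v : ℕ → X} (hv : WeaklyNull v) {w : ℕ → Y} {C : ℝ}
    (h : ∀ (s : Finset ℕ) (a : ℕ → ℝ), (∀ i ∈ s, 0 ≤ a i) →
      ‖∑ i ∈ s, a i • w i‖ ≤ C * ‖∑ i ∈ s, a i • v i‖) : WeaklyNull w := by
  refine weaklyNull_of_eventually_lt fun φ ε hε => ?_
  by_contra hcon
  have hB : 0 < ‖φ‖ * |C| + 1 := by positivity
  obtain ⟨s, a, ha, ha1, hsmall⟩ :=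
    hv.exists_convex_combination_norm_lt (not_eventually.1 hcon) (div_pos hε hB)
  rw [lt_div_iff₀ hB] at hsmall
  have hle : ε ≤ ‖φ‖ * (|C| * ‖∑ i ∈ s, a i • v i‖) := calc
    ε = ∑ i ∈ s, a i * ε := by rw [← Finset.sum_mul, ha1, one_mul]
    _ ≤ ∑ i ∈ s, a i * φ (w i) :=
      Finset.sum_le_sum fun i hi => mul_le_mul_of_nonneg_left (not_lt.1 (ha i hi).1) (ha i hi).2
    _ = φ (∑ i ∈ s, a i • w i) := by simp only [map_sum, map_smul, smul_eq_mul]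
    _ ≤ ‖φ‖ * ‖∑ i ∈ s, a i • w i‖ := (le_abs_self _).trans (φ.le_opNorm _)
    _ ≤ ‖φ‖ * (|C| * ‖∑ i ∈ s, a i • v i‖) := by
      gcongr
      exact (h s a fun i hi => (ha i hi).2).trans (by gcongr; exact le_abs_self C)
  linarith [norm_nonneg (∑ i ∈ s, a i • v i)]

end FunctionalAnalysis

section LatticeGroup

open LatticeOrderedAddCommGroup (IsSolid)

variable {E : Type*} [AddCommGroup E] [Lattice E] [IsOrderedAddMonoid E]

theorem abs_le_iff_neg_le_and_le {a b : E} : |a| ≤ b ↔ -b ≤ a ∧ a ≤ b := by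
  rw [abs_le', and_comm, neg_le]

theorem eq_zero_of_abs_le_zero {a : E} (h : |a| ≤ 0) : a = 0 :=
  le_antisymm ((le_abs_self a).trans h) (neg_nonpos.1 ((neg_le_abs a).trans h))

theorem add_inf_le_inf_add_inf {a b c : E} (ha : 0 ≤ a) (hb : 0 ≤ b) (hc : 0 ≤ c) :
    (a + b) ⊓ c ≤ a ⊓ c + b ⊓ c := by
  rw [add_inf, inf_add, inf_add]
  refine le_inf (le_inf inf_le_left ?_) (le_inf ?_ ?_)
  · exact inf_le_right.trans (le_add_of_nonneg_right hb)
  · exact inf_le_right.trans (le_add_of_nonneg_left ha)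
  · exact inf_le_right.trans (le_add_of_nonneg_left hc)

theorem abs_sub_inf_sup_neg_le {z a b : E} (hb : 0 ≤ b) (hz : |z| ≤ a + b) :
    |z - z ⊓ a ⊔ -a| ≤ b := by
  obtain ⟨hneg, hle⟩ := abs_le_iff_neg_le_and_le.1 hz
  refine abs_le_iff_neg_le_and_le.2 ⟨?_, ?_⟩
  · rw [neg_le_sub_iff_le_add]
    refine sup_le (inf_le_left.trans (le_add_of_nonneg_right hb)) ?_
    rw [neg_add] at hneg
    exact sub_le_iff_le_add.1 (by rwa [sub_eq_add_neg])
  · rw [sub_le_iff_le_add', ← sub_le_iff_le_add]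
    exact (le_inf (sub_le_self _ hb) (sub_le_iff_le_add.2 hle)).trans le_sup_left

theorem exists_add_eq_of_abs_le_add {z a b : E} (ha : 0 ≤ a) (hb : 0 ≤ b) (hz : |z| ≤ a + b) :
    ∃ z₁ z₂, z₁ + z₂ = z ∧ |z₁| ≤ |z| ⊓ a ∧ |z₂| ≤ |z| ⊓ b := by
  set c := |z| ⊓ a with hc
  have hc0 : 0 ≤ c := le_inf (abs_nonneg z) ha
  have hcb : |z| - c ≤ |z| ⊓ b := by
    refine le_inf (sub_le_self _ hc0) ?_
    rw [hc, sub_inf, sub_self]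
    exact sup_le hb (sub_le_iff_le_add'.2 hz)
  refine ⟨z ⊓ c ⊔ -c, z - z ⊓ c ⊔ -c, add_sub_cancel _ _, abs_le_iff_neg_le_and_le.2
    ⟨le_sup_right, sup_le inf_le_right (neg_le_self hc0)⟩, ?_⟩
  exact (abs_sub_inf_sup_neg_le (sub_nonneg.2 inf_le_left) (add_sub_cancel _ _).ge).trans hcb

open scoped Pointwise in
theorem setOf_mem_abs_le_add {I : AddSubgroup E} (hI : IsSolid (I : Set E)) {a b : E}
    (ha : 0 ≤ a) (hb : 0 ≤ b) :
    {z | z ∈ I ∧ |z| ≤ a + b} = {z | z ∈ I ∧ |z| ≤ a} + {z | z ∈ I ∧ |z| ≤ b} := by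
  ext z
  constructor
  · rintro ⟨hzI, hz⟩
    obtain ⟨z₁, z₂, rfl, h₁, h₂⟩ := exists_add_eq_of_abs_le_add ha hb hz
    exact ⟨z₁, ⟨hI hzI (h₁.trans inf_le_left), h₁.trans inf_le_right⟩,
      z₂, ⟨hI hzI (h₂.trans inf_le_left), h₂.trans inf_le_right⟩, rfl⟩
  · rintro ⟨z₁, ⟨hz₁, h₁⟩, z₂, ⟨hz₂, h₂⟩, rfl⟩
    exact ⟨add_mem hz₁ hz₂, (abs_add_le _ _).trans (add_le_add h₁ h₂)⟩

theorem inf_abs_eq_zero_of_disjoint {I J : AddSubgroup E} (hI : IsSolid (I : Set E))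
    (hJ : IsSolid (J : Set E)) (hIJ : Disjoint I J) {a b : E} (ha : a ∈ I) (hb : b ∈ J) :
    |a| ⊓ |b| = 0 := by
  have hnn : |(|a| ⊓ |b|)| = |a| ⊓ |b| := abs_of_nonneg (le_inf (abs_nonneg _) (abs_nonneg _))
  exact AddSubgroup.disjoint_def.1 hIJ (hI ha (hnn.le.trans inf_le_left))
    (hJ hb (hnn.le.trans inf_le_right))

/-- The disjoint complement `Sᵈ` of a subset of a lattice ordered group. -/
def disjointCompl (S : Set E) : AddSubgroup E where
  carrier := {z | ∀ s ∈ S, |z| ⊓ |s| = 0}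
  zero_mem' s _ := by simp
  neg_mem' hz s hs := by simpa using hz s hs
  add_mem' {y z} hy hz s hs := by
    refine le_antisymm ?_ (le_inf (abs_nonneg _) (abs_nonneg _))
    calc |y + z| ⊓ |s| ≤ (|y| + |z|) ⊓ |s| := inf_le_inf_right _ (abs_add_le y z)
      _ ≤ |y| ⊓ |s| + |z| ⊓ |s| :=
        add_inf_le_inf_add_inf (abs_nonneg _) (abs_nonneg _) (abs_nonneg _)
      _ = 0 := by rw [hy s hs, hz s hs, add_zero]

theorem mem_disjointCompl {S : Set E} {z : E} : z ∈ disjointCompl S ↔ ∀ s ∈ S, |z| ⊓ |s| = 0 :=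
  Iff.rfl

theorem mem_disjointCompl_singleton {z s : E} : z ∈ disjointCompl {s} ↔ |z| ⊓ |s| = 0 := by
  simp [mem_disjointCompl]

theorem isSolid_disjointCompl (S : Set E) : IsSolid (disjointCompl S : Set E) :=
  fun _ hz _ hyz s hs => le_antisymm ((inf_le_inf_right _ hyz).trans (hz s hs).le)
    (le_inf (abs_nonneg _) (abs_nonneg _))

theorem subset_disjointCompl_disjointCompl (S : Set E) :
    S ⊆ disjointCompl (disjointCompl S : Set E) :=
  fun s hs z hz => by rw [inf_comm, hz s hs]

theorem disjoint_disjointCompl_disjointCompl (S : Set E) :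
    Disjoint (disjointCompl S) (disjointCompl (disjointCompl S : Set E)) := by
  refine AddSubgroup.disjoint_def.2 fun {z} hz hz' => eq_zero_of_abs_le_zero ?_
  simpa using (hz' z hz).le

theorem disjoint_bands_of_inf_eq_zero {a b : E} (hab : |a| ⊓ |b| = 0) :
    Disjoint (disjointCompl (disjointCompl {a} : Set E))
      (disjointCompl (disjointCompl {b} : Set E)) := by
  refine (disjoint_disjointCompl_disjointCompl {b}).mono_left fun z hz => ?_
  exact mem_disjointCompl_singleton.2 (hz b (mem_disjointCompl_singleton.2 (by rwa [inf_comm])))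

theorem sum_abs_le_of_disjoint {ι : Type*} {s : Finset ι} {z : ι → E} {u : E} (hu : 0 ≤ u)
    (hz : ∀ i ∈ s, |z i| ≤ u) (hd : (s : Set ι).Pairwise fun i j => |z i| ⊓ |z j| = 0) :
    ∑ i ∈ s, |z i| ≤ u := by
  classical
  induction s using Finset.induction_on with
  | empty => simpa using hu
  | insert a s ha ih =>
    rw [Finset.coe_insert, Set.pairwise_insert_of_notMem (by simpa using ha)] at hd
    have hsum : ∑ i ∈ s, |z i| ∈ disjointCompl {z a} :=
      sum_mem fun i hi => mem_disjointCompl_singleton.2 (by simpa using (hd.2 i hi).2)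
    have hinf : |z a| ⊓ ∑ i ∈ s, |z i| = 0 := by
      have hnn : 0 ≤ ∑ i ∈ s, |z i| := Finset.sum_nonneg fun _ _ => abs_nonneg _
      rwa [mem_disjointCompl_singleton, abs_of_nonneg hnn, inf_comm] at hsum
    rw [Finset.sum_insert ha, ← inf_add_sup, hinf, zero_add]
    exact sup_le (hz a (Finset.mem_insert_self _ _))
      (ih (fun i hi => hz i (Finset.mem_insert_of_mem hi)) hd.1)

end LatticeGroup

section Sequences

variable {E : Type*}

theorem DisjointSeq.comp_injective [AddCommGroup E] [Lattice E] {x : ℕ → E} (hx : DisjointSeq x)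
    {s : ℕ → ℕ} (hs : Function.Injective s) : DisjointSeq (x ∘ s) :=
  fun _ _ hmn => hx _ _ (hs.ne hmn)

theorem DisjointSeq.abs [AddCommGroup E] [Lattice E] [IsOrderedAddMonoid E] {x : ℕ → E}
    (hx : DisjointSeq x) : DisjointSeq fun n => |x n| :=
  fun m n hmn => by simpa using hx m n hmn

theorem DisjointSeq.posPart_inf_negPart_eq_zero [AddCommGroup E] [Lattice E]
    [IsOrderedAddMonoid E] {x : ℕ → E} (hx : DisjointSeq x) (m n : ℕ) :
    (x m)⁺ ⊓ (x n)⁻ = 0 := by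
  rcases eq_or_ne m n with rfl | hmn
  · exact _root_.posPart_inf_negPart_eq_zero _
  · refine le_antisymm ((inf_le_inf ?_ ?_).trans (hx m n hmn).le)
      (le_inf (posPart_nonneg _) (negPart_nonneg _))
    · exact sup_le (le_abs_self _) (abs_nonneg _)
    · exact sup_le (neg_le_abs _) (abs_nonneg _)

variable [NormedAddCommGroup E] [NormedSpace ℝ E]

theorem WeaklyPSummable.comp_injective {p : ℝ} {x : ℕ → E} (hx : WeaklyPSummable p x) {s : ℕ → ℕ}
    (hs : Function.Injective s) : WeaklyPSummable p (x ∘ s) :=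
  fun f => (hx f).comp_injective hs

theorem WeaklyPSummable.weaklyNull {p : ℝ} (hp : 0 < p) {x : ℕ → E} (hx : WeaklyPSummable p x) :
    WeaklyNull x := by
  intro f
  have h := (hx f).tendsto_atTop_zero.rpow_const (p := p⁻¹) (Or.inr (by positivity))
  rw [Real.zero_rpow (inv_ne_zero hp.ne')] at h
  rw [tendsto_zero_iff_abs_tendsto_zero]
  exact h.congr fun n => Real.rpow_rpow_inv (abs_nonneg _) hp.ne'

end Sequences

section Schur

theorem exists_forall_eqOn_abs_tsum_mul_le {ι : Type*} {a : ℕ → ι → ℝ}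
    (ha : ∀ n, Summable fun i => |a n i|)
    (h : ∀ c : ι → ℝ, (∀ i, |c i| ≤ 1) → Tendsto (fun n => ∑' i, c i * a n i) atTop (𝓝 0))
    {ε : ℝ} (hε : 0 < ε) :
    ∃ (N : ℕ) (s : Finset ι) (c₀ : ι → ℝ), (∀ i, |c₀ i| ≤ 1) ∧ ∀ c : ι → ℝ, (∀ i, |c i| ≤ 1) →
      Set.EqOn c c₀ s → ∀ n ≥ N, |∑' i, c i * a n i| ≤ ε := by
  have hcube : ∀ c : ι → Set.Icc (-1 : ℝ) 1, ∀ i, |(c i : ℝ)| ≤ 1 := fun c i => abs_le.2 (c i).2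
  let A : ℕ → Set (ι → Set.Icc (-1 : ℝ) 1) := fun N =>
    ⋂ n ≥ N, {c | |∑' i, (c i : ℝ) * a n i| ≤ ε}
  have hclosed : ∀ N, IsClosed (A N) := fun N => isClosed_biInter fun n _ => by
    refine isClosed_le (continuous_tsum (fun i => by fun_prop) (ha n) fun i c => ?_).abs
      continuous_const
    rw [norm_mul]
    exact mul_le_of_le_one_left (abs_nonneg _) (hcube c i)
  have hcover : ⋃ N, A N = Set.univ := Set.eq_univ_of_forall fun c => by
    have hc := (h (fun i => c i) (hcube c)).abs
    rw [abs_zero] at hc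
    obtain ⟨N, hN⟩ := eventually_atTop.1 (hc.eventually_le_const hε)
    exact Set.mem_iUnion.2 ⟨N, Set.mem_iInter₂.2 hN⟩
  have : Nonempty (Set.Icc (-1 : ℝ) 1) := ⟨⟨0, by simp⟩⟩
  obtain ⟨N, c₀, hc₀⟩ := nonempty_interior_of_iUnion_of_closed hclosed hcover
  obtain ⟨s, u, hu, hus⟩ := isOpen_pi_iff.1 isOpen_interior c₀ hc₀
  refine ⟨N, s, fun i => c₀ i, hcube c₀, fun c hc hcs n hn => ?_⟩
  have hmem : (fun i => ⟨c i, abs_le.1 (hc i)⟩ : ι → Set.Icc (-1 : ℝ) 1) ∈ A N :=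
    interior_subset (hus fun i hi => by
      convert (hu i hi).2
      exact Subtype.ext (hcs hi))
  exact Set.mem_iInter₂.1 hmem n hn

theorem tsum_abs_le_of_forall_eqOn {ι : Type*} {b : ι → ℝ} (hb : Summable fun i => |b i|)
    {s : Finset ι} {c₀ : ι → ℝ} (hc₀ : ∀ i, |c₀ i| ≤ 1) {ε : ℝ}
    (h : ∀ c : ι → ℝ, (∀ i, |c i| ≤ 1) → Set.EqOn c c₀ s → |∑' i, c i * b i| ≤ ε) :
    ∑' i, |b i| ≤ ε + ∑ i ∈ s, 2 * |b i| := by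
  classical
  let c : ι → ℝ := fun i => if i ∈ s then c₀ i else SignType.sign (b i)
  have hc : ∀ i, |c i| ≤ 1 := fun i => by
    by_cases hi : i ∈ s
    · simp [c, hi, hc₀]
    · rcases lt_trichotomy (b i) 0 with hneg | hzero | hpos <;> simp [c, *]
  have habs : ∀ i, |c i * b i| ≤ |b i| := fun i => by
    rw [abs_mul]
    exact mul_le_of_le_one_left (abs_nonneg _) (hc i)
  have hle : ∀ i, |b i| ≤ c i * b i + if i ∈ s then 2 * |b i| else 0 := fun i => by
    by_cases hi : i ∈ s
    · simp only [hi, if_true]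
      linarith [neg_abs_le (c i * b i), habs i]
    · simp [c, hi, sign_mul_self]
  have hsum : HasSum (fun i => if i ∈ s then 2 * |b i| else 0) (∑ i ∈ s, 2 * |b i|) := by
    simpa using hasSum_sum_of_ne_finset_zero (s := s)
      (f := fun i => if i ∈ s then 2 * |b i| else 0) (by simp +contextual)
  calc ∑' i, |b i| ≤ ∑' i, c i * b i + ∑ i ∈ s, 2 * |b i| :=
        hasSum_le hle hb.hasSum ((hb.of_norm_bounded habs).hasSum.add hsum)
    _ ≤ ε + ∑ i ∈ s, 2 * |b i| := by
      gcongr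
      exact (le_abs_self _).trans (h c hc fun i hi => by simp [c, Finset.mem_coe.1 hi])

/-- The Schur property of `ℓ¹`, by Baire category on the cube `[-1, 1] ^ ι`. -/
theorem tendsto_tsum_abs_of_tendsto_tsum_mul {ι : Type*} {a : ℕ → ι → ℝ}
    (ha : ∀ n, Summable fun i => |a n i|)
    (h : ∀ c : ι → ℝ, (∀ i, |c i| ≤ 1) → Tendsto (fun n => ∑' i, c i * a n i) atTop (𝓝 0)) :
    Tendsto (fun n => ∑' i, |a n i|) atTop (𝓝 0) := by
  classical
  have hcoord : ∀ i, Tendsto (fun n => a n i) atTop (𝓝 0) := fun i => by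
    simpa [Pi.single_apply] using
      h (Pi.single i 1) fun j => by by_cases hj : j = i <;> simp [hj]
  refine tendsto_order.2 ⟨fun b hb => ?_, fun ε hε => ?_⟩
  · exact .of_forall fun n => hb.trans_le (tsum_nonneg fun i => abs_nonneg _)
  obtain ⟨N, s, c₀, hc₀, hs⟩ := exists_forall_eqOn_abs_tsum_mul_le ha h (half_pos hε)
  have hfin : Tendsto (fun n => ∑ i ∈ s, 2 * |a n i|) atTop (𝓝 0) := by
    simpa using tendsto_finsetSum s fun i _ => ((hcoord i).abs.const_mul 2)
  filter_upwards [hfin.eventually_lt_const (half_pos hε), eventually_ge_atTop N] with n hn hnN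
  linarith [tsum_abs_le_of_forall_eqOn (ha n) hc₀ fun c hc hcs => hs c hc hcs n hnN]

theorem WeaklyNull.tendsto_diagonal_of_sum_abs_le {V : Type*} [NormedAddCommGroup V]
    [NormedSpace ℝ V] {f : ℕ → V} (hf : WeaklyNull f) {ψ : ℕ → V →L[ℝ] ℝ} {C : ℝ}
    (hψ : ∀ (s : Finset ℕ) (v : V), ∑ m ∈ s, |ψ m v| ≤ C * ‖v‖) :
    Tendsto (fun n => ψ n (f n)) atTop (𝓝 0) := by
  have hsummable : ∀ v, Summable fun m => |ψ m v| := fun v =>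
    summable_of_sum_le (fun _ => abs_nonneg _) fun s => hψ s v
  have hbound : ∀ c : ℕ → ℝ, (∀ m, |c m| ≤ 1) → ∀ v m, ‖c m * ψ m v‖ ≤ |ψ m v| := by
    intro c hc v m
    rw [norm_mul]
    exact mul_le_of_le_one_left (abs_nonneg _) (hc m)
  have hweak : ∀ c : ℕ → ℝ, (∀ m, |c m| ≤ 1) →
      Tendsto (fun n => ∑' m, c m * ψ m (f n)) atTop (𝓝 0) := by
    intro c hc
    have hs : ∀ v, Summable fun m => c m * ψ m v := fun v =>
      (hsummable v).of_norm_bounded (hbound c hc v)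
    let L : V →ₗ[ℝ] ℝ :=
      { toFun := fun v => ∑' m, c m * ψ m v
        map_add' := fun v w => by simp only [map_add, mul_add, (hs v).tsum_add (hs w)]
        map_smul' := fun r v => by
          simp only [map_smul, smul_eq_mul, mul_left_comm _ r, tsum_mul_left, RingHom.id_apply] }
    exact hf (L.mkContinuous C fun v =>
      (tsum_of_norm_bounded (hsummable v).hasSum (hbound c hc v)).trans
        ((hsummable v).tsum_le_of_sum_le fun s => hψ s v))
  exact squeeze_zero_norm (fun n => (hsummable (f n)).le_tsum n fun _ _ => abs_nonneg _)
    (tendsto_tsum_abs_of_tendsto_tsum_mul (fun n => hsummable (f n)) hweak)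

end Schur

section Modulus

open LatticeOrderedAddCommGroup (IsSolid)

variable {E : Type*} [NormedAddCommGroup E] [NormedSpace ℝ E] [Lattice E]

/-- `g` is the modulus of the part of the functional `f` that lives on `I`: for `y ≥ 0`,
`g y = sup {f z | z ∈ I, |z| ≤ y}`. For `I = E` this is the Riesz–Kantorovich formula for `|f|`. -/
def IsModulusOn (I : AddSubgroup E) (f g : E →L[ℝ] ℝ) : Prop :=
  ∀ y, 0 ≤ y → IsLUB (f '' {z | z ∈ I ∧ |z| ≤ y}) (g y)

/-- Disjointness `g ∧ h = 0` of positive functionals, through the Riesz–Kantorovich formula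
`(g ∧ h) y = inf {g a + h b | a, b ≥ 0, a + b = y}`. -/
def DisjointFunctionals (g h : E →L[ℝ] ℝ) : Prop :=
  ∀ y, 0 ≤ y → ∀ δ > 0, ∃ a b, 0 ≤ a ∧ 0 ≤ b ∧ a + b = y ∧ g a ≤ δ ∧ h b ≤ δ

theorem IsModulusOn.exists_lt {I : AddSubgroup E} {f g : E →L[ℝ] ℝ}
    (h : IsModulusOn I f g) {y : E} (hy : 0 ≤ y) {δ : ℝ} (hδ : 0 < δ) :
    ∃ z ∈ I, |z| ≤ y ∧ g y - δ < f z := by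
  obtain ⟨_, ⟨z, ⟨hz, hzy⟩, rfl⟩, hlt, -⟩ := (h y hy).exists_between (sub_lt_self _ hδ)
  exact ⟨z, hz, hzy, hlt⟩

variable [IsOrderedAddMonoid E]

theorem apply_le_apply_of_le {g : E →L[ℝ] ℝ} (hg : ∀ y, 0 ≤ y → 0 ≤ g y) {a b : E} (h : a ≤ b) :
    g a ≤ g b :=
  sub_nonneg.1 (by simpa only [map_sub] using hg _ (sub_nonneg.2 h))

theorem abs_apply_le_apply_abs {g : E →L[ℝ] ℝ} (hg : ∀ y, 0 ≤ y → 0 ≤ g y) (y : E) :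
    |g y| ≤ g |y| := by
  refine abs_le'.2 ⟨apply_le_apply_of_le hg (le_abs_self y), ?_⟩
  rw [← map_neg]
  exact apply_le_apply_of_le hg (neg_le_abs y)

section Existence

variable [HasSolidNorm E]

theorem exists_continuousLinearMap_of_additive_on_cone {q : E → ℝ} {C : ℝ}
    (hadd : ∀ a b, 0 ≤ a → 0 ≤ b → q (a + b) = q a + q b)
    (hnonneg : ∀ a, 0 ≤ a → 0 ≤ q a) (hle : ∀ a, 0 ≤ a → q a ≤ C * ‖a‖) :
    ∃ g : E →L[ℝ] ℝ, ∀ a, 0 ≤ a → g a = q a := by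
  have hsub : ∀ a b : E, 0 ≤ a → 0 ≤ b → q (a - b)⁺ - q (a - b)⁻ = q a - q b := by
    intro a b ha hb
    have e : (a - b)⁺ + b = a + (a - b)⁻ := by
      rw [← sub_eq_sub_iff_add_eq_add, posPart_sub_negPart]
    have e' := congrArg q e
    rw [hadd _ _ (posPart_nonneg _) hb, hadd _ _ ha (negPart_nonneg _)] at e'
    linarith
  let L : E →+ ℝ := AddMonoidHom.mk' (fun y => q y⁺ - q y⁻) fun x y => by
    have e : x + y = (x⁺ + y⁺) - (x⁻ + y⁻) := by
      rw [add_sub_add_comm, posPart_sub_negPart, posPart_sub_negPart]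
    rw [e, hsub _ _ (add_nonneg (posPart_nonneg _) (posPart_nonneg _))
        (add_nonneg (negPart_nonneg _) (negPart_nonneg _)),
      hadd _ _ (posPart_nonneg _) (posPart_nonneg _),
      hadd _ _ (negPart_nonneg _) (negPart_nonneg _)]
    ring
  have hL : ∀ y, ‖L y‖ ≤ C * ‖y‖ := by
    intro y
    have hpos := hnonneg _ (posPart_nonneg y)
    have hneg := hnonneg _ (negPart_nonneg y)
    have habs := hle _ (abs_nonneg y)
    rw [norm_abs_eq_norm, ← posPart_add_negPart y,
      hadd _ _ (posPart_nonneg y) (negPart_nonneg y)] at habs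
    change |q y⁺ - q y⁻| ≤ _
    exact abs_le.2 ⟨by linarith, by linarith⟩
  refine ⟨L.toRealLinearMap (AddMonoidHomClass.continuous_of_bound L C hL), fun a ha => ?_⟩
  have h0 : q 0 = 0 := by simpa using hadd 0 0 le_rfl le_rfl
  change q a⁺ - q a⁻ = q a
  rw [posPart_of_nonneg ha, negPart_of_nonneg ha, h0, sub_zero]

theorem exists_isModulusOn {I : AddSubgroup E} (hI : IsSolid (I : Set E)) (f : E →L[ℝ] ℝ) :
    ∃ g, IsModulusOn I f g := by
  let S : E → Set ℝ := fun y => f '' {z | z ∈ I ∧ |z| ≤ y}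
  have hzero : ∀ y, 0 ≤ y → (0 : ℝ) ∈ S y := fun y hy =>
    ⟨0, ⟨I.zero_mem, by simpa using hy⟩, map_zero f⟩
  have hbound : ∀ y, 0 ≤ y → ∀ r ∈ S y, r ≤ ‖f‖ * ‖y‖ := by
    rintro y hy _ ⟨z, ⟨-, hz⟩, rfl⟩
    refine (le_abs_self _).trans (f.le_opNorm_of_le ?_)
    exact norm_le_norm_of_abs_le_abs (by rwa [abs_of_nonneg hy])
  have hlub : ∀ y, 0 ≤ y → IsLUB (S y) (sSup (S y)) := fun y hy =>
    isLUB_csSup ⟨0, hzero y hy⟩ ⟨_, hbound y hy⟩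
  have hadd : ∀ a b, 0 ≤ a → 0 ≤ b → sSup (S (a + b)) = sSup (S a) + sSup (S b) := by
    intro a b ha hb
    refine (hlub _ (add_nonneg ha hb)).unique ?_
    simp only [S, setOf_mem_abs_le_add hI ha hb, Set.image_add]
    exact (hlub a ha).add (hlub b hb)
  obtain ⟨g, hg⟩ := exists_continuousLinearMap_of_additive_on_cone hadd
    (fun a ha => (hlub a ha).1 (hzero a ha)) fun a ha => csSup_le ⟨0, hzero a ha⟩ (hbound a ha)
  exact ⟨g, fun y hy => by rw [hg y hy]; exact hlub y hy⟩

end Existence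

namespace IsModulusOn

variable {I : AddSubgroup E} {f g : E →L[ℝ] ℝ}

theorem nonneg (h : IsModulusOn I f g) {y : E} (hy : 0 ≤ y) : 0 ≤ g y :=
  (h y hy).1 ⟨0, ⟨I.zero_mem, by simpa using hy⟩, map_zero f⟩

theorem apply_le (h : IsModulusOn I f g) {z y : E} (hz : z ∈ I) (hzy : |z| ≤ y) : f z ≤ g y :=
  (h y ((abs_nonneg z).trans hzy)).1 ⟨z, ⟨hz, hzy⟩, rfl⟩

theorem abs_apply_le (h : IsModulusOn I f g) {z : E} (hz : z ∈ I) : |f z| ≤ g |z| := by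
  refine abs_le'.2 ⟨h.apply_le hz le_rfl, ?_⟩
  rw [← map_neg]
  exact h.apply_le (neg_mem hz) (abs_neg z).le

theorem apply_abs_eq_zero_of_disjoint (h : IsModulusOn I f g) {J : AddSubgroup E}
    (hJ : IsSolid (J : Set E)) (hIJ : Disjoint I J) {y : E} (hy : y ∈ J) : g |y| = 0 := by
  refine le_antisymm ((h _ (abs_nonneg y)).2 ?_) (h.nonneg (abs_nonneg y))
  rintro _ ⟨z, ⟨hz, hzy⟩, rfl⟩
  rw [AddSubgroup.disjoint_def.1 hIJ hz (hJ hy hzy), map_zero]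

theorem disjointFunctionals (h : IsModulusOn I f g) {J : AddSubgroup E} {f' g' : E →L[ℝ] ℝ}
    (h' : IsModulusOn J f' g') (hI : IsSolid (I : Set E)) (hIJ : Disjoint I J) :
    DisjointFunctionals g g' := by
  intro y hy δ hδ
  obtain ⟨z, hz, hzy, hlt⟩ := h.exists_lt hy hδ
  refine ⟨y - |z|, |z|, sub_nonneg.2 hzy, abs_nonneg z, sub_add_cancel _ _, ?_, ?_⟩
  · rw [map_sub]
    linarith [h.apply_le hz le_rfl]
  · exact (h'.apply_abs_eq_zero_of_disjoint hI hIJ.symm hz).trans_le hδ.le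

end IsModulusOn

variable [HasSolidNorm E]

theorem sum_abs_apply_le_of_disjoint {ι : Type*} {s : Finset ι} {z : ι → E} {u : E} (hu : 0 ≤ u)
    (hz : ∀ i ∈ s, |z i| ≤ u) (hd : (s : Set ι).Pairwise fun i j => |z i| ⊓ |z j| = 0)
    (h : E →L[ℝ] ℝ) : ∑ i ∈ s, |h (z i)| ≤ ‖h‖ * ‖u‖ := by
  have hsign : ∀ i, ∃ w, |w| = |z i| ∧ h w = |h (z i)| := fun i => by
    rcases abs_choice (h (z i)) with e | e
    · exact ⟨z i, rfl, e.symm⟩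
    · exact ⟨-z i, abs_neg _, by rw [map_neg, e]⟩
  choose w hw hhw using hsign
  have hwu : |∑ i ∈ s, w i| ≤ u := calc
    |∑ i ∈ s, w i| ≤ ∑ i ∈ s, |w i| :=
      Finset.le_sum_of_subadditive (fun x : E => |x|) abs_zero.le abs_add_le s w
    _ = ∑ i ∈ s, |z i| := Finset.sum_congr rfl fun i _ => hw i
    _ ≤ u := sum_abs_le_of_disjoint hu hz hd
  calc ∑ i ∈ s, |h (z i)| = h (∑ i ∈ s, w i) := by simp only [map_sum, hhw]
    _ ≤ ‖h‖ * ‖u‖ := (le_abs_self _).trans (h.le_opNorm_of_le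
      (norm_le_norm_of_abs_le_abs (by rwa [abs_of_nonneg hu])))

theorem weaklyNull_of_isModulusOn {I : ℕ → AddSubgroup E} (hI : ∀ n, IsSolid (I n : Set E))
    (hdisj : Pairwise fun m n => Disjoint (I m) (I n)) {f g : ℕ → E →L[ℝ] ℝ}
    (hf : WeaklyNull f) (hg : ∀ n, IsModulusOn (I n) (f n) (g n)) : WeaklyNull g := by
  refine weaklyNull_of_norm_le_one fun φ hφ => ?_
  obtain ⟨U, hU, hUφ⟩ := exists_ultrafilter_tendsto_bidual hφ
  choose z hzI hzy hzf using fun n (y : E) =>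
    (hg n).exists_lt (abs_nonneg y) (Nat.one_div_pos_of_nat (α := ℝ) (n := n))
  choose ψ hψ using fun n => exists_bidual_tendsto U (z := z n) (C := 1)
    (hU.mono fun y hy => (norm_le_norm_of_abs_le_abs (hzy n y)).trans hy)
  have hsum : ∀ (s : Finset ℕ) h, ∑ m ∈ s, |ψ m h| ≤ 1 * ‖h‖ := by
    intro s h
    refine le_of_tendsto (tendsto_finsetSum _ fun m _ => (hψ m h).abs) ?_
    filter_upwards [hU] with y hy
    refine (sum_abs_apply_le_of_disjoint (abs_nonneg y) (fun m _ => hzy m y) (fun m _ n _ hmn =>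
      inf_abs_eq_zero_of_disjoint (hI m) (hI n) (hdisj hmn) (hzI m y) (hzI n y)) h).trans ?_
    rw [norm_abs_eq_norm, mul_comm]
    exact mul_le_mul_of_nonneg_right hy (norm_nonneg h)
  have hle : ∀ n, ‖φ (g n)‖ ≤ ψ n (f n) + 1 / ((n : ℝ) + 1) := fun n =>
    le_of_tendsto_of_tendsto' (hUφ (g n)).abs ((hψ n (f n)).add_const _) fun y => by
      linarith [abs_apply_le_apply_abs (fun y hy => (hg n).nonneg hy) y, hzf n y]
  refine squeeze_zero_norm hle ?_
  simpa using (hf.tendsto_diagonal_of_sum_abs_le hsum).add tendsto_one_div_add_atTop_nhds_zero_nat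

theorem exists_positive_disjoint_weaklyNull {x : ℕ → E} (hx : DisjointSeq x)
    {f : ℕ → E →L[ℝ] ℝ} (hf : WeaklyNull f) :
    ∃ g : ℕ → E →L[ℝ] ℝ, (∀ n y, 0 ≤ y → 0 ≤ g n y) ∧ WeaklyNull g ∧
      (∀ m n, m ≠ n → DisjointFunctionals (g m) (g n)) ∧ ∀ n, |f n (x n)| ≤ g n |x n| := by
  let I : ℕ → AddSubgroup E := fun n => disjointCompl (disjointCompl {x n} : Set E)
  have hI : ∀ n, IsSolid (I n : Set E) := fun n => isSolid_disjointCompl _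
  have hdisj : Pairwise fun m n => Disjoint (I m) (I n) := fun m n hmn =>
    disjoint_bands_of_inf_eq_zero (hx m n hmn)
  choose g hg using fun n => exists_isModulusOn (hI n) (f n)
  exact ⟨g, fun n _ => (hg n).nonneg, weaklyNull_of_isModulusOn hI hdisj hf hg,
    fun m n hmn => (hg m).disjointFunctionals (hg n) (hI m) (hdisj hmn),
    fun n => (hg n).abs_apply_le (subset_disjointCompl_disjointCompl _ rfl)⟩

/-- For `g`, `h` the moduli of `f` on the bands of the positive and of the negative parts,
`|f |x n|| ≤ (g - h) (x n)`. -/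
theorem WeaklyPSummable.abs {p : ℝ} (hp : 0 ≤ p) {x : ℕ → E} (hd : DisjointSeq x)
    (hx : WeaklyPSummable p x) : WeaklyPSummable p fun n => |x n| := by
  intro f
  let S : Set E := Set.range fun n => (x n)⁺
  have hdisj := disjoint_disjointCompl_disjointCompl S
  obtain ⟨g, hg⟩ := exists_isModulusOn (isSolid_disjointCompl (disjointCompl S : Set E)) f
  obtain ⟨h, hh⟩ := exists_isModulusOn (isSolid_disjointCompl S) f
  have hpos : ∀ n, (x n)⁺ ∈ disjointCompl (disjointCompl S : Set E) := fun n =>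
    subset_disjointCompl_disjointCompl S ⟨n, rfl⟩
  have hneg : ∀ n, (x n)⁻ ∈ disjointCompl S := by
    rintro n _ ⟨m, rfl⟩
    rw [abs_of_nonneg (negPart_nonneg _), abs_of_nonneg (posPart_nonneg _), inf_comm]
    exact hd.posPart_inf_negPart_eq_zero m n
  have hle : ∀ n, |f (|x n|)| ≤ |(g - h) (x n)| := fun n => by
    have hfpos := hg.abs_apply_le (hpos n)
    have hfneg := hh.abs_apply_le (hneg n)
    have hgneg := hg.apply_abs_eq_zero_of_disjoint (isSolid_disjointCompl S) hdisj.symm (hneg n)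
    have hhpos := hh.apply_abs_eq_zero_of_disjoint (isSolid_disjointCompl _) hdisj (hpos n)
    rw [abs_of_nonneg (posPart_nonneg _)] at hfpos hhpos
    rw [abs_of_nonneg (negPart_nonneg _)] at hfneg hgneg
    calc |f (|x n|)| = |f (x n)⁺ + f (x n)⁻| := by rw [← map_add, posPart_add_negPart]
      _ ≤ g (x n)⁺ + h (x n)⁻ := (abs_add_le _ _).trans (add_le_add hfpos hfneg)
      _ = (g - h) ((x n)⁺ - (x n)⁻) := by
        rw [sub_apply, map_sub, map_sub, hgneg, hhpos]
        ring
      _ ≤ |(g - h) (x n)| := by rw [posPart_sub_negPart]; exact le_abs_self _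
  exact (hx (g - h)).of_nonneg_of_le (fun n => Real.rpow_nonneg (abs_nonneg _) p) fun n =>
    Real.rpow_le_rpow (abs_nonneg _) (hle n) hp

end Modulus

section Criterion

variable {E : Type*} [NormedAddCommGroup E] [NormedSpace ℝ E] [Lattice E]

theorem DisjointDPP.tendsto {p : ℝ} (hE : DisjointDPP p E) {x : ℕ → E} (hd : DisjointSeq x)
    (hx : WeaklyPSummable p x) {f : ℕ → E →L[ℝ] ℝ} (hf : WeaklyNull f) :
    Tendsto (fun n => f n (x n)) atTop (𝓝 0) := by
  rw [Metric.tendsto_nhds]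
  intro ε hε
  filter_upwards [Metric.tendstoUniformlyOn_iff.1 (hE x hd hx f hf) ε hε] with n hn
  rw [dist_comm]
  exact hn (x n) ⟨n, rfl⟩

theorem disjointDPP_of_tendsto_diagonal {p : ℝ}
    (H : ∀ (x : ℕ → E) (f : ℕ → E →L[ℝ] ℝ), DisjointSeq x → WeaklyPSummable p x → WeaklyNull f →
      Tendsto (fun n => f n (x n)) atTop (𝓝 0)) : DisjointDPP p E := by
  intro x hd hx f hf
  refine Metric.tendstoUniformlyOn_iff.2 fun ε hε => ?_
  by_contra hcon
  obtain ⟨r, hr, hbad⟩ := extraction_of_frequently_atTop (not_eventually.1 hcon)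
  have hfar : ∀ n, ∃ m, ε ≤ |f (r n) (x m)| := fun n => by
    obtain ⟨_, ⟨m, rfl⟩, hm⟩ : ∃ y ∈ Set.range x, ¬dist ((0 : E → ℝ) y) (f (r n) y) < ε := by
      simpa using hbad n
    exact ⟨m, by simpa using hm⟩
  choose m hm using hfar
  have hnull : WeaklyNull (f ∘ r) := hf.comp_tendsto hr.tendsto_atTop
  -- Each `f n (x j)` with `j` fixed tends to zero, so `m` takes each value finitely often.
  have hm_atTop : Tendsto m atTop atTop := by
    have hne : ∀ j, ∀ᶠ n in atTop, m n ≠ j := fun j => by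
      have hj := (hnull (NormedSpace.inclusionInDoubleDual ℝ E (x j))).abs
      rw [abs_zero] at hj
      filter_upwards [hj.eventually_lt_const hε] with n hn h
      exact (hm n).not_gt (by simpa [h] using hn)
    refine tendsto_atTop.2 fun b => ?_
    filter_upwards [(Finset.range b).eventually_all.2 fun j _ => hne j] with n hn
    by_contra h
    exact hn (m n) (Finset.mem_range.2 (not_le.1 h)) rfl
  obtain ⟨s, hs, hms⟩ := strictMono_subseq_of_tendsto_atTop hm_atTop
  have hlim := (H (x ∘ m ∘ s) (f ∘ r ∘ s) (hd.comp_injective hms.injective)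
    (hx.comp_injective hms.injective) (hnull.comp_tendsto hs.tendsto_atTop)).abs
  rw [abs_zero] at hlim
  exact hε.not_ge (ge_of_tendsto' hlim fun n => hm (s n))

theorem disjointDPP_of_positive [IsOrderedAddMonoid E] [HasSolidNorm E] {p : ℝ} (hp : 0 ≤ p)
    (H : ∀ (x : ℕ → E) (g : ℕ → E →L[ℝ] ℝ), DisjointSeq x → WeaklyPSummable p x → (∀ n, 0 ≤ x n) →
      (∀ n y, 0 ≤ y → 0 ≤ g n y) → WeaklyNull g →
      (∀ m n, m ≠ n → DisjointFunctionals (g m) (g n)) →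
      Tendsto (fun n => g n (x n)) atTop (𝓝 0)) : DisjointDPP p E := by
  refine disjointDPP_of_tendsto_diagonal fun x f hd hx hf => ?_
  obtain ⟨g, hg, hgw, hgd, hle⟩ := exists_positive_disjoint_weaklyNull hd hf
  exact squeeze_zero_norm hle
    (H (fun n => |x n|) g hd.abs (hx.abs hp hd) (fun n => abs_nonneg _) hg hgw hgd)

end Criterion

section Polarization

variable {ι V W : Type*} [Fintype ι] [DecidableEq ι] [AddCommGroup V] [AddCommGroup W]

theorem sum_neg_one_pow_card_filter_forall_mem_compl (r : ι → ι) :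
    ∑ u : Finset ι with ∀ i, r i ∈ uᶜ, (-1 : ℤ) ^ u.card =
      if Function.Surjective r then 1 else 0 := by
  have hfilter : ({u | ∀ i, r i ∈ uᶜ} : Finset (Finset ι)) = (Finset.univ.image r)ᶜ.powerset := by
    ext u
    simp only [Finset.mem_filter_univ, Finset.mem_powerset, Finset.subset_iff, Finset.mem_compl,
      Finset.mem_image, Finset.mem_univ, true_and, not_exists]
    exact ⟨fun h j hj i hi => h i (hi ▸ hj), fun h i hi => h hi i rfl⟩
  have hsurj : (Finset.univ.image r)ᶜ = ∅ ↔ Function.Surjective r := by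
    simp [Finset.compl_eq_empty_iff, Finset.eq_univ_iff_forall, Function.Surjective]
  rw [hfilter, Finset.sum_powerset_neg_one_pow_card]
  simp only [hsurj]

theorem sum_surjective_eq_sum_perm (F : (ι → ι) → W) :
    ∑ r : ι → ι with Function.Surjective r, F r = ∑ σ : Equiv.Perm ι, F σ := by
  refine (Finset.sum_bij (fun (σ : Equiv.Perm ι) _ => ⇑σ) (fun σ _ => by simp [σ.surjective])
    (fun _ _ _ _ h => DFunLike.coe_injective h) (fun r hr => ?_) fun _ _ => rfl).symm
  have hr : Function.Surjective r := by simpa using hr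
  exact ⟨Equiv.ofBijective r hr.bijective_of_finite, Finset.mem_univ _, rfl⟩

theorem sum_neg_one_pow_card_smul_map_sum_compl {R : Type*} [CommRing R] [Module R V] [Module R W]
    (T : MultilinearMap R (fun _ : ι => V) W) (v : ι → V) :
    ∑ u : Finset ι, (-1 : ℤ) ^ u.card • T (fun _ => ∑ i ∈ uᶜ, v i) =
      ∑ σ : Equiv.Perm ι, T (fun i => v (σ i)) := by
  have hexpand : ∀ u : Finset ι, T (fun _ => ∑ i ∈ uᶜ, v i) =
      ∑ r : ι → ι, if ∀ i, r i ∈ uᶜ then T (fun i => v (r i)) else 0 := by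
    intro u
    rw [T.map_sum_finset (fun _ j => v j) fun _ => uᶜ, ← Finset.sum_filter]
    exact Finset.sum_congr (by ext r; simp) fun _ _ => rfl
  simp only [hexpand, Finset.smul_sum, smul_ite, smul_zero]
  rw [Finset.sum_comm, ← sum_surjective_eq_sum_perm fun r => T fun i => v (r i), Finset.sum_filter]
  refine Finset.sum_congr rfl fun r _ => ?_
  rw [← Finset.sum_filter, ← Finset.sum_smul, sum_neg_one_pow_card_filter_forall_mem_compl,
    ite_smul, one_smul, zero_smul]

theorem map_eq_inv_factorial_smul_sum_diagonal [Module ℝ V] [Module ℝ W]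
    (T : MultilinearMap ℝ (fun _ : ι => V) W)
    (hT : ∀ (σ : Equiv.Perm ι) (v : ι → V), T (fun i => v (σ i)) = T v) (v : ι → V) :
    T v = ((Fintype.card ι).factorial : ℝ)⁻¹ •
      ∑ u : Finset ι, (-1 : ℤ) ^ u.card • T fun _ => ∑ i ∈ uᶜ, v i := by
  rw [sum_neg_one_pow_card_smul_map_sum_compl, eq_inv_smul_iff₀ (by positivity)]
  simp [hT, Fintype.card_perm, Nat.cast_smul_eq_nsmul]

end Polarization

theorem ext_of_diagonal {ι V W : Type*} [Finite ι] [AddCommGroup V] [Module ℝ V] [AddCommGroup W]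
    [Module ℝ W] {S T : MultilinearMap ℝ (fun _ : ι => V) W}
    (hS : ∀ (σ : Equiv.Perm ι) (v : ι → V), S (fun i => v (σ i)) = S v)
    (hT : ∀ (σ : Equiv.Perm ι) (v : ι → V), T (fun i => v (σ i)) = T v)
    (h : ∀ x, (S fun _ => x) = T fun _ => x) : S = T := by
  classical
  have := Fintype.ofFinite ι
  ext v
  rw [map_eq_inv_factorial_smul_sum_diagonal S hS, map_eq_inv_factorial_smul_sum_diagonal T hT]
  simp only [h]

section MultilinearBounds

theorem norm_sum_le_of_unit_ball {ι V : Type*} [Fintype ι] [SeminormedAddCommGroup V] {v : ι → V}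
    (hv : ∀ i, ‖v i‖ ≤ 1) (u : Finset ι) : ‖∑ i ∈ u, v i‖ ≤ Fintype.card ι := by
  refine (norm_sum_le_of_le _ fun i _ => hv i).trans ?_
  simpa using Finset.card_le_univ u

variable {k : ℕ} {V W : Type*} [NormedAddCommGroup V] [NormedSpace ℝ V]
  [NormedAddCommGroup W] [NormedSpace ℝ W]

theorem norm_smul_inv_norm_smul (x : V) : ‖x‖ • ‖x‖⁻¹ • x = x := by
  rcases eq_or_ne x 0 with rfl | hx
  · simp
  · exact smul_inv_smul₀ (norm_ne_zero_iff.2 hx) x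

theorem norm_inv_norm_smul_le_one (x : V) : ‖‖x‖⁻¹ • x‖ ≤ 1 := by
  rw [norm_smul, norm_inv, norm_norm]
  exact inv_mul_le_one

theorem norm_map_le_of_unit_ball {ι : Type*} [Fintype ι] (T : MultilinearMap ℝ (fun _ : ι => V) W)
    {C : ℝ} (hT : ∀ v, (∀ i, ‖v i‖ ≤ 1) → ‖T v‖ ≤ C) (v : ι → V) : ‖T v‖ ≤ C * ∏ i, ‖v i‖ := by
  have hprod : 0 ≤ ∏ i, ‖v i‖ := Finset.prod_nonneg fun _ _ => norm_nonneg _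
  calc ‖T v‖ = ‖(∏ i, ‖v i‖) • T fun i => ‖v i‖⁻¹ • v i‖ := by
        simp only [← T.map_smul_univ, norm_smul_inv_norm_smul]
    _ = (∏ i, ‖v i‖) * ‖T fun i => ‖v i‖⁻¹ • v i‖ := by
        rw [norm_smul, Real.norm_of_nonneg hprod]
    _ ≤ (∏ i, ‖v i‖) * C :=
        mul_le_mul_of_nonneg_left (hT _ fun i => norm_inv_norm_smul_le_one (v i)) hprod
    _ = C * ∏ i, ‖v i‖ := mul_comm _ _

/-- The sums in the polarization formula stay in the ball of radius `k`, so they are `k • y` with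
`‖y‖ ≤ 1`. -/
theorem exists_isCompact_of_weaklyCompactMap_diagonal (hk : 1 ≤ k)
    (T : ContinuousMultilinearMap ℝ (fun _ : Fin k => V) W)
    (hT : ∀ (σ : Equiv.Perm (Fin k)) (v : Fin k → V), T (fun i => v (σ i)) = T v)
    (hc : WeaklyCompactMap fun x => T fun _ => x) :
    ∃ K : Set (WeakSpace ℝ W), IsCompact K ∧
      ∀ v, (∀ i, ‖v i‖ ≤ 1) → toWeakSpace ℝ W (T v) ∈ K := by
  have hk0 : (0 : ℝ) < k := by exact_mod_cast hk
  set K₀ := closure (toWeakSpace ℝ W '' ((fun x => T fun _ => x) '' Metric.closedBall 0 1))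
  let S : (Finset (Fin k) → WeakSpace ℝ W) → WeakSpace ℝ W := fun w =>
    ((k.factorial : ℝ)⁻¹) • ∑ u, (-1 : ℤ) ^ u.card • ((k : ℝ) ^ k • w u)
  have hS : Continuous S := by fun_prop
  refine ⟨S '' Set.univ.pi fun _ => K₀, (isCompact_univ_pi fun _ => hc).image hS, fun v hv => ?_⟩
  let y : Finset (Fin k) → V := fun u => (k : ℝ)⁻¹ • ∑ i ∈ uᶜ, v i
  refine ⟨fun u => toWeakSpace ℝ W (T fun _ => y u), fun u _ => subset_closure
    ⟨_, ⟨y u, mem_closedBall_zero_iff.2 ?_, rfl⟩, rfl⟩, ?_⟩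
  · rw [norm_smul, norm_inv, Real.norm_of_nonneg hk0.le, inv_mul_le_iff₀ hk0, mul_one]
    simpa using norm_sum_le_of_unit_ball hv uᶜ
  · have hy : ∀ u : Finset (Fin k), (T fun _ => ∑ i ∈ uᶜ, v i) = (k : ℝ) ^ k • T fun _ => y u := by
      intro u
      have h := T.map_smul_univ (fun _ => (k : ℝ)) fun _ => y u
      simpa [y, smul_inv_smul₀ hk0.ne'] using h
    have h := map_eq_inv_factorial_smul_sum_diagonal T.toMultilinearMap hT v
    simp only [ContinuousMultilinearMap.coe_coe, hy, Fintype.card_fin] at h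
    simp only [S, h, map_smul, map_sum, map_zsmul]

end MultilinearBounds

namespace RegPoly

variable {k : ℕ} {E : Type*} [NormedAddCommGroup E] [NormedSpace ℝ E] [Lattice E]

theorem exists_form (P : RegPoly k E) :
    ∃ T : ContinuousMultilinearMap ℝ (fun _ : Fin k => E) ℝ,
      (∀ (σ : Equiv.Perm (Fin k)) v, T (fun i => v (σ i)) = T v) ∧ ∀ x, T (fun _ => x) = P x := by
  obtain ⟨P₁, P₂, ⟨T₁, h₁, -, hP₁⟩, ⟨T₂, h₂, -, hP₂⟩, hP⟩ := P.exists_eq_sub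
  exact ⟨T₁ - T₂, fun σ v => by simp [h₁ σ v, h₂ σ v], fun x => by simp [hP, hP₁, hP₂]⟩

/-- The symmetric `k`-linear form associated with the polynomial `P`. -/
def form (P : RegPoly k E) : ContinuousMultilinearMap ℝ (fun _ : Fin k => E) ℝ :=
  P.exists_form.choose

theorem form_perm (P : RegPoly k E) (σ : Equiv.Perm (Fin k)) (v : Fin k → E) :
    P.form (fun i => v (σ i)) = P.form v :=
  P.exists_form.choose_spec.1 σ v

theorem form_diagonal (P : RegPoly k E) (x : E) : P.form (fun _ => x) = P x :=
  P.exists_form.choose_spec.2 x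

theorem form_eq {P : RegPoly k E} {T : ContinuousMultilinearMap ℝ (fun _ : Fin k => E) ℝ}
    (hT : ∀ (σ : Equiv.Perm (Fin k)) v, T (fun i => v (σ i)) = T v)
    (h : ∀ x, P x = T fun _ => x) : P.form = T :=
  ContinuousMultilinearMap.toMultilinearMap_injective <|
    ext_of_diagonal P.form_perm hT fun x => (P.form_diagonal x).trans (h x)

@[simp]
theorem form_zero : (0 : RegPoly k E).form = 0 := form_eq (by simp) (by simp)

theorem form_add (P Q : RegPoly k E) : (P + Q).form = P.form + Q.form :=
  form_eq (fun σ v => by simp [form_perm]) fun x => by simp [form_diagonal]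

theorem form_smul (c : ℝ) (P : RegPoly k E) : (c • P).form = c • P.form :=
  form_eq (fun σ v => by simp [form_perm]) fun x => by simp [form_diagonal]

variable [IsOrderedAddMonoid E]

theorem form_le_form {P Q : RegPoly k E} (h : P ≤ Q) {v : Fin k → E} (hv : ∀ i, 0 ≤ v i) :
    P.form v ≤ Q.form v := by
  obtain ⟨T, hT, hT0, hTd⟩ := le_iff.1 h
  have hQ : Q.form = P.form + T := form_eq (fun σ v => by simp [form_perm, hT σ v]) fun x => by
    simp [form_diagonal, ← hTd]
  simpa [hQ] using hT0 v hv

theorem le_of_form_le_form {P Q : RegPoly k E}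
    (h : ∀ v : Fin k → E, (∀ i, 0 ≤ v i) → P.form v ≤ Q.form v) : P ≤ Q :=
  le_iff.2 ⟨Q.form - P.form, fun σ v => by simp [form_perm], fun v hv => by simpa using h v hv,
    fun x => by simp [form_diagonal]⟩

variable [HasSolidNorm E]

theorem abs_apply_le_norm_mul_pow (P : RegPoly k E) (x : E) : |P x| ≤ ‖x‖ ^ k * ‖P‖ := by
  rw [← norm_smul_inv_norm_smul x, map_smul_self, abs_mul, abs_pow, abs_norm,
    norm_smul_inv_norm_smul x]
  exact mul_le_mul_of_nonneg_left (P.abs_apply_le_regNorm (norm_inv_norm_smul_le_one x))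
    (by positivity)

theorem abs_form_le (P : RegPoly k E) {v : Fin k → E} (hv : ∀ i, ‖v i‖ ≤ 1) :
    |P.form v| ≤ 2 ^ k * k ^ k * ‖P‖ := by
  have hterm : ∀ u : Finset (Fin k), |(-1 : ℤ) ^ u.card • P (∑ i ∈ uᶜ, v i)| ≤ k ^ k * ‖P‖ := by
    intro u
    rw [zsmul_eq_mul, abs_mul, Int.cast_pow, Int.cast_neg, Int.cast_one, abs_neg_one_pow, one_mul]
    refine (P.abs_apply_le_norm_mul_pow _).trans (mul_le_mul_of_nonneg_right ?_ (norm_nonneg P))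
    exact pow_le_pow_left₀ (norm_nonneg _) (by simpa using norm_sum_le_of_unit_ball hv uᶜ) k
  have hform := map_eq_inv_factorial_smul_sum_diagonal P.form.toMultilinearMap P.form_perm v
  simp only [ContinuousMultilinearMap.coe_coe, form_diagonal, smul_eq_mul] at hform
  rw [hform, abs_mul, abs_of_nonneg (by positivity)]
  calc _ ≤ 1 * |∑ u : Finset (Fin k), (-1 : ℤ) ^ u.card • P (∑ i ∈ uᶜ, v i)| :=
        mul_le_mul_of_nonneg_right
          (inv_le_one_of_one_le₀ (by exact_mod_cast Nat.factorial_pos _)) (abs_nonneg _)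
    _ ≤ ∑ _u : Finset (Fin k), (k : ℝ) ^ k * ‖P‖ := by
        rw [one_mul]
        exact (Finset.abs_sum_le_sum_abs _ _).trans (Finset.sum_le_sum fun u _ => hterm u)
    _ = 2 ^ k * k ^ k * ‖P‖ := by simp [mul_assoc]

variable (k E) in
/-- The association of its symmetric `k`-linear form to a regular polynomial, as a continuous
linear map. -/
def formCLM : RegPoly k E →L[ℝ] ContinuousMultilinearMap ℝ (fun _ : Fin k => E) ℝ :=
  LinearMap.mkContinuous { toFun := form, map_add' := form_add, map_smul' := form_smul }
    (2 ^ k * k ^ k) fun P => ContinuousMultilinearMap.opNorm_le_bound (by positivity)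
      (norm_map_le_of_unit_ball P.form.toMultilinearMap fun _ hv => P.abs_form_le hv)

variable (k E) in
/-- The `k`-linear map that sends `v` to the functional `P ↦ P.form v`; through it, scalar valued
polynomials on `E` come from the universal map into the dual of `𝒫ʳ(ᵏE)`. -/
def evalForm : ContinuousMultilinearMap ℝ (fun _ : Fin k => E) (RegPoly k E →L[ℝ] ℝ) :=
  (formCLM k E).flipMultilinear

@[simp]
theorem evalForm_apply (v : Fin k → E) (P : RegPoly k E) : evalForm k E v P = P.form v := rfl

end RegPoly

section DunfordPettis

variable {E : Type*} [NormedAddCommGroup E] [NormedSpace ℝ E] [Lattice E] {p : ℝ} {x : ℕ → E}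

namespace DisjointDPP

theorem tendsto_multilinear_of_bidual (hE : DisjointDPP p E) (hd : DisjointSeq x)
    (hx : WeaklyPSummable p x) {k : ℕ}
    {A : ℕ → ContinuousMultilinearMap ℝ (fun _ : Fin (k + 1) => E) ℝ}
    (hA : ∀ φ : (E →L[ℝ] ℝ) →L[ℝ] ℝ, ‖φ‖ ≤ 1 →
      Tendsto (fun n => φ ((A n).curryRight fun _ => x n)) atTop (𝓝 0)) :
    Tendsto (fun n => A n fun _ => x n) atTop (𝓝 0) := by
  have hsnoc : ∀ n, (Fin.snoc (fun _ : Fin k => x n) (x n) : Fin (k + 1) → E) = fun _ => x n :=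
    fun n => Fin.snoc_init_self fun _ => x n
  simpa [hsnoc] using hE.tendsto hd hx (weaklyNull_of_norm_le_one hA)

/-- Passing to the bidual in the last variable keeps the values of the forms inside `C`, so the
number of variables can be lowered one at a time. -/
theorem tendsto_multilinear (hE : DisjointDPP p E) (hd : DisjointSeq x)
    (hx : WeaklyPSummable p x) {C : Set (ℕ → ℝ)} (hC : IsClosed C)
    (hC0 : ∀ c ∈ C, Tendsto c atTop (𝓝 0)) {k : ℕ}
    {A : ℕ → ContinuousMultilinearMap ℝ (fun _ : Fin k => E) ℝ}
    (hA : ∀ v, (∀ i, ‖v i‖ ≤ 1) → (fun n => A n v) ∈ C) :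
    Tendsto (fun n => A n fun _ => x n) atTop (𝓝 0) := by
  induction k with
  | zero =>
    refine (hC0 _ (hA (fun _ => 0) fun i => i.elim0)).congr fun n => ?_
    exact congrArg (A n) (Subsingleton.elim _ _)
  | succ k ih =>
    refine hE.tendsto_multilinear_of_bidual hd hx fun φ hφ => ?_
    refine ih (A := fun n => φ.compContinuousMultilinearMap (A n).curryRight) fun v hv => ?_
    refine bidual_apply_mem_of_isClosed hC (h := fun n => (A n).curryRight v) (fun y hy => ?_) hφ
    refine hA (Fin.snoc v y) (Fin.forall_fin_succ'.2 ⟨fun i => ?_, ?_⟩)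
    · simpa using hv i
    · simpa using hy

theorem tendsto_multilinear_const (hE : DisjointDPP p E) (hp : 0 < p) (hd : DisjointSeq x)
    (hx : WeaklyPSummable p x) {k : ℕ} (hk : 1 ≤ k)
    (A : ContinuousMultilinearMap ℝ (fun _ : Fin k => E) ℝ) :
    Tendsto (fun n => A fun _ => x n) atTop (𝓝 0) := by
  induction k, hk using Nat.le_induction with
  | base =>
    refine (hx.weaklyNull hp (A.curryRight 0)).congr fun n => ?_
    exact congrArg A (funext <| Fin.forall_fin_one.2 rfl)
  | succ k _ ih =>
    exact hE.tendsto_multilinear_of_bidual hd hx fun φ _ =>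
      ih (φ.compContinuousMultilinearMap A.curryRight)

theorem exists_subseq_tendsto_multilinear_of_isCompact (hE : DisjointDPP p E) (hp : 0 < p)
    (hd : DisjointSeq x) (hx : WeaklyPSummable p x) {F : Type*} [NormedAddCommGroup F]
    [NormedSpace ℝ F] {k : ℕ} (hk : 1 ≤ k)
    (T : ContinuousMultilinearMap ℝ (fun _ : Fin k => E) F)
    {K : Set (WeakSpace ℝ F)} (hK : IsCompact K)
    (hT : ∀ v, (∀ i, ‖v i‖ ≤ 1) → toWeakSpace ℝ F (T v) ∈ K) :
    ∃ s : ℕ → ℕ, Tendsto (fun n => T fun _ => x (s n)) atTop (𝓝 0) := by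
  choose f hf hfT using fun n => exists_dual_vector'' ℝ (T fun _ => x n)
  obtain ⟨s, g, hs, hg⟩ := exists_subseq_tendsto_on_isCompact hK hf
  have hds := hd.comp_injective hs.injective
  have hxs := hx.comp_injective hs.injective
  let S : WeakSpace ℝ F → ℕ → ℝ := fun z n => (f (s n) - g) ((toWeakSpace ℝ F).symm z)
  have hS : Continuous S :=
    continuous_pi fun n => WeakBilin.eval_continuous (topDualPairing ℝ F).flip (f (s n) - g)
  have hnull : ∀ c ∈ S '' K, Tendsto c atTop (𝓝 0) := by
    rintro _ ⟨z, hz, rfl⟩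
    exact tendsto_sub_nhds_zero_iff.2 (hg ((toWeakSpace ℝ F).symm z) hz)
  have hdiff : Tendsto (fun n => (f (s n) - g) (T fun _ => x (s n))) atTop (𝓝 0) :=
    hE.tendsto_multilinear hds hxs (hK.image hS).isClosed hnull
      (A := fun n => (f (s n) - g).compContinuousMultilinearMap T) fun v hv => ⟨_, hT v hv, rfl⟩
  have hlim : Tendsto (fun n => g (T fun _ => x (s n))) atTop (𝓝 0) :=
    hE.tendsto_multilinear_const hp hds hxs hk (g.compContinuousMultilinearMap T)
  refine ⟨s, tendsto_zero_iff_norm_tendsto_zero.2 ?_⟩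
  simpa [hfT] using hdiff.add hlim

theorem tendsto_multilinear_of_isCompact (hE : DisjointDPP p E) (hp : 0 < p) (hd : DisjointSeq x)
    (hx : WeaklyPSummable p x) {F : Type*} [NormedAddCommGroup F] [NormedSpace ℝ F] {k : ℕ}
    (hk : 1 ≤ k) (T : ContinuousMultilinearMap ℝ (fun _ : Fin k => E) F)
    {K : Set (WeakSpace ℝ F)} (hK : IsCompact K)
    (hT : ∀ v, (∀ i, ‖v i‖ ≤ 1) → toWeakSpace ℝ F (T v) ∈ K) :
    Tendsto (fun n => T fun _ => x n) atTop (𝓝 0) := by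
  refine tendsto_of_subseq_tendsto fun r hr => ?_
  obtain ⟨t, -, ht⟩ := strictMono_subseq_of_tendsto_atTop hr
  obtain ⟨s, hs⟩ := hE.exists_subseq_tendsto_multilinear_of_isCompact hp
    (hd.comp_injective ht.injective) (hx.comp_injective ht.injective) hk T hK hT
  exact ⟨t ∘ s, hs⟩

end DisjointDPP

theorem DisjointDPP.disjointPConvergent (hE : DisjointDPP p E) (hp : 0 < p) {k : ℕ} (hk : 1 ≤ k)
    {F : Type*} [NormedAddCommGroup F] [NormedSpace ℝ F] [PartialOrder F] {P : E → F}
    (hP : IsPosHomPoly k P) (hc : WeaklyCompactMap P) : DisjointPConvergent p P := by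
  obtain ⟨T, hT, -, hPT⟩ := hP
  obtain rfl : P = fun x => T fun _ => x := funext hPT
  obtain ⟨K, hK, hTK⟩ := exists_isCompact_of_weaklyCompactMap_diagonal hk T hT hc
  exact fun x hd hx => hE.tendsto_multilinear_of_isCompact hp hd hx hk T hK hTK

theorem DisjointDPP.tendsto_regPoly [IsOrderedAddMonoid E] [HasSolidNorm E]
    (hE : DisjointDPP p E) (hd : DisjointSeq x) (hx : WeaklyPSummable p x) {k : ℕ}
    {P : ℕ → RegPoly k E} (hP : WeaklyNull P) : Tendsto (fun n => P n (x n)) atTop (𝓝 0) := by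
  let B := WeakDual.toStrongDual ⁻¹'
    Metric.closedBall (0 : StrongDual ℝ (RegPoly k E)) ‖RegPoly.evalForm k E‖
  let S : WeakDual ℝ (RegPoly k E) → ℕ → ℝ := fun Φ n => Φ (P n)
  have hS : Continuous S := continuous_pi fun n => WeakDual.eval_continuous (P n)
  have hSB : IsCompact (S '' B) := (WeakDual.isCompact_closedBall _ _).image hS
  have hnull : ∀ c ∈ S '' B, Tendsto c atTop (𝓝 0) := by
    rintro _ ⟨Φ, -, rfl⟩
    exact hP (WeakDual.toStrongDual Φ)
  have hmem : ∀ v : Fin k → E, (∀ i, ‖v i‖ ≤ 1) → (fun n => (P n).form v) ∈ S '' B := fun v hv => by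
    refine ⟨StrongDual.toWeakDual (RegPoly.evalForm k E v), mem_closedBall_zero_iff.2 ?_, rfl⟩
    exact (RegPoly.evalForm k E).unit_le_opNorm ((pi_norm_le_iff_of_nonneg zero_le_one).2 hv)
  simpa only [RegPoly.form_diagonal] using
    hE.tendsto_multilinear hd hx hSB.isClosed hnull hmem

end DunfordPettis

section PowerPolynomials

theorem tendsto_zero_of_pow {ι : Type*} {l : Filter ι} {a : ι → ℝ} (ha : ∀ i, 0 ≤ a i) {k : ℕ}
    (hk : k ≠ 0) (h : Tendsto (fun i => a i ^ k) l (𝓝 0)) : Tendsto a l (𝓝 0) := by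
  have hroot := h.rpow_const (p := (k : ℝ)⁻¹) (Or.inr (by positivity))
  simpa [Real.pow_rpow_inv_natCast, ha, hk] using hroot

variable {k : ℕ} {E : Type*} [NormedAddCommGroup E] [NormedSpace ℝ E]

/-- The symmetric form `(v₁, …, vₖ) ↦ g v₁ ⋯ g vₖ`, whose polynomial is `gᵏ`. -/
def powForm (k : ℕ) (g : E →L[ℝ] ℝ) : ContinuousMultilinearMap ℝ (fun _ : Fin k => E) ℝ :=
  (ContinuousMultilinearMap.mkPiAlgebra ℝ (Fin k) ℝ).compContinuousLinearMap fun _ => g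

@[simp]
theorem powForm_apply (g : E →L[ℝ] ℝ) (v : Fin k → E) : powForm k g v = ∏ i, g (v i) := rfl

theorem powForm_perm (g : E →L[ℝ] ℝ) (σ : Equiv.Perm (Fin k)) (v : Fin k → E) :
    powForm k g (fun i => v (σ i)) = powForm k g v :=
  Equiv.prod_comp σ fun i => g (v i)

variable [Lattice E]

theorem isPosHomPoly_pow (k : ℕ) {g : E →L[ℝ] ℝ} (hg : ∀ y, 0 ≤ y → 0 ≤ g y) :
    IsPosHomPoly k fun x => g x ^ k :=
  ⟨powForm k g, powForm_perm g, fun v hv => by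
    simpa using Finset.prod_nonneg fun i _ => hg (v i) (hv i), by simp⟩

theorem map_nonpos_of_le_prod {ι : Type*} [Fintype ι] [Nonempty ι]
    (S : MultilinearMap ℝ (fun _ : ι => E) ℝ) {g h : E →L[ℝ] ℝ} (hgh : DisjointFunctionals g h)
    (hg : ∀ y, 0 ≤ y → 0 ≤ g y) (hh : ∀ y, 0 ≤ y → 0 ≤ h y)
    (hSg : ∀ v, (∀ i, 0 ≤ v i) → S v ≤ ∏ i, g (v i))
    (hSh : ∀ v, (∀ i, 0 ≤ v i) → S v ≤ ∏ i, h (v i)) {v : ι → E} (hv : ∀ i, 0 ≤ v i) :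
    S v ≤ 0 := by
  classical
  obtain ⟨j⟩ := ‹Nonempty ι›
  set G := ∏ i ∈ Finset.univ.erase j, g (v i)
  set H := ∏ i ∈ Finset.univ.erase j, h (v i)
  have hG : 0 ≤ G := Finset.prod_nonneg fun i _ => hg _ (hv i)
  have hH : 0 ≤ H := Finset.prod_nonneg fun i _ => hh _ (hv i)
  have hprod : ∀ (f : E →L[ℝ] ℝ) y, ∏ i, f (Function.update v j y i) =
      f y * ∏ i ∈ Finset.univ.erase j, f (v i) := fun f y => by
    rw [← Finset.mul_prod_erase _ _ (Finset.mem_univ j), Function.update_self]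
    congr 1
    exact Finset.prod_congr rfl fun i hi => by
      rw [Function.update_of_ne (Finset.ne_of_mem_erase hi)]
  have hupdate : ∀ y, 0 ≤ y → ∀ i, 0 ≤ Function.update v j y i := fun y hy =>
    (Function.forall_update_iff v fun _ z => 0 ≤ z).2 ⟨hy, fun i _ => hv i⟩
  have hbound : ∀ δ > 0, S v ≤ δ * (G + H) := by
    intro δ hδ
    obtain ⟨a, b, ha, hb, hab, hga, hhb⟩ := hgh (v j) (hv j) δ hδ
    calc S v = S (Function.update v j a) + S (Function.update v j b) := by
          rw [← S.map_update_add, hab, Function.update_eq_self]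
      _ ≤ g a * G + h b * H := by
          rw [← hprod, ← hprod]
          exact add_le_add (hSg _ (hupdate a ha)) (hSh _ (hupdate b hb))
      _ ≤ δ * G + δ * H := by gcongr
      _ = δ * (G + H) := (mul_add _ _ _).symm
  have hlim : Tendsto (fun δ => δ * (G + H)) (𝓝[>] 0) (𝓝 (0 * (G + H))) :=
    (tendsto_nhdsWithin_of_tendsto_nhds tendsto_id).mul_const _
  rw [zero_mul] at hlim
  exact ge_of_tendsto hlim (eventually_mem_nhdsWithin.mono hbound)

theorem abs_pow_le_mul_apply_abs [IsOrderedAddMonoid E] [HasSolidNorm E] (hk : k ≠ 0)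
    {g : E →L[ℝ] ℝ} (hg : ∀ y, 0 ≤ y → 0 ≤ g y) {M : ℝ} (hM : ‖g‖ ≤ M) {x : E} (hx : ‖x‖ ≤ 1) :
    |g x ^ k| ≤ M ^ (k - 1) * g |x| := by
  have hgx : 0 ≤ g |x| := hg _ (abs_nonneg x)
  have hgM : g |x| ≤ M :=
    (Real.le_norm_self _).trans ((g.unit_le_opNorm |x| (by rwa [norm_abs_eq_norm])).trans hM)
  calc |g x ^ k| = |g x| ^ k := abs_pow _ _
    _ ≤ g |x| ^ k := pow_le_pow_left₀ (abs_nonneg _) (abs_apply_le_apply_abs hg x) k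
    _ = g |x| ^ (k - 1) * g |x| := (pow_sub_one_mul hk _).symm
    _ ≤ M ^ (k - 1) * g |x| := by gcongr

namespace RegPoly

theorem form_ofPos_pow {g : E →L[ℝ] ℝ} (hg : ∀ y, 0 ≤ y → 0 ≤ g y) :
    (ofPos (isPosHomPoly_pow k hg)).form = powForm k g :=
  form_eq (powForm_perm g) (by simp)

variable [IsOrderedAddMonoid E]

theorem isAbs_self {P : RegPoly k E} (hP : 0 ≤ P) : IsAbs P P := by
  refine ⟨?_, fun R hR => hR (by simp)⟩
  rintro R (rfl | rfl)
  · exact le_rfl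
  · exact (neg_nonpos.2 hP).trans hP

theorem ofPos_nonneg {P : E → ℝ} (hP : IsPosHomPoly k P) : 0 ≤ ofPos hP := by
  rw [le_iff]
  simpa using hP

theorem isGLB_pow_of_disjoint (hk : k ≠ 0) {g h : E →L[ℝ] ℝ} (hg : ∀ y, 0 ≤ y → 0 ≤ g y)
    (hh : ∀ y, 0 ≤ y → 0 ≤ h y) (hgh : DisjointFunctionals g h) :
    IsGLB {ofPos (isPosHomPoly_pow k hg), ofPos (isPosHomPoly_pow k hh)} 0 := by
  have : NeZero k := ⟨hk⟩
  refine ⟨?_, fun R hR => le_of_form_le_form fun v hv => ?_⟩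
  · rintro _ (rfl | rfl) <;> exact ofPos_nonneg _
  have hRg : ∀ v : Fin k → E, (∀ i, 0 ≤ v i) → R.form v ≤ ∏ i, g (v i) := fun v hv => by
    simpa [form_ofPos_pow hg] using form_le_form (hR (Set.mem_insert _ _)) hv
  have hRh : ∀ v : Fin k → E, (∀ i, 0 ≤ v i) → R.form v ≤ ∏ i, h (v i) := fun v hv => by
    simpa [form_ofPos_pow hh] using form_le_form (hR (Set.mem_insert_of_mem _ rfl)) hv
  rw [form_zero]
  exact map_nonpos_of_le_prod R.form.toMultilinearMap hgh hg hh hRg hRh hv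

theorem disjointSeq_pow (hk : k ≠ 0) {g : ℕ → E →L[ℝ] ℝ} (hg : ∀ n y, 0 ≤ y → 0 ≤ g n y)
    (hd : ∀ m n, m ≠ n → DisjointFunctionals (g m) (g n)) :
    DisjointSeq fun n => ofPos (isPosHomPoly_pow k (hg n)) := fun m n hmn =>
  ⟨_, _, isAbs_self (ofPos_nonneg _), isAbs_self (ofPos_nonneg _),
    isGLB_pow_of_disjoint hk (hg m) (hg n) (hd m n hmn)⟩

variable [HasSolidNorm E]

theorem norm_le_of_nonneg {P : RegPoly k E} (hP : 0 ≤ P) {C : ℝ}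
    (h : ∀ x, ‖x‖ ≤ 1 → |P x| ≤ C) : ‖P‖ ≤ C :=
  (norm_eq_of_isAbs (isAbs_self hP)).trans_le (supNorm_le h)

theorem sum_smul_apply {ι : Type*} (s : Finset ι) (a : ι → ℝ) (P : ι → RegPoly k E) (x : E) :
    (∑ i ∈ s, a i • P i) x = ∑ i ∈ s, a i * P i x := by
  have h := map_sum (evalForm k E fun _ => x) (fun i => a i • P i) s
  simpa only [evalForm_apply, form_diagonal, smul_apply] using h

theorem norm_sum_smul_pow_le (hk : k ≠ 0) {ι : Type*} {g : ι → E →L[ℝ] ℝ}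
    (hg : ∀ i y, 0 ≤ y → 0 ≤ g i y) {M : ℝ} (hM : 0 ≤ M) (hgM : ∀ i, ‖g i‖ ≤ M) {s : Finset ι}
    {a : ι → ℝ} (ha : ∀ i ∈ s, 0 ≤ a i) :
    ‖∑ i ∈ s, a i • ofPos (isPosHomPoly_pow k (hg i))‖ ≤ M ^ (k - 1) * ‖∑ i ∈ s, a i • g i‖ := by
  refine norm_le_of_nonneg (Finset.sum_nonneg fun i hi => ?_) fun x hx => ?_
  · simpa using smul_le_smul' (ofPos_nonneg (isPosHomPoly_pow k (hg i))) (ha i hi)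
  rw [sum_smul_apply]
  calc |∑ i ∈ s, a i * g i x ^ k| ≤ ∑ i ∈ s, |a i * g i x ^ k| := Finset.abs_sum_le_sum_abs _ _
    _ ≤ ∑ i ∈ s, a i * (M ^ (k - 1) * g i |x|) := by
        refine Finset.sum_le_sum fun i hi => ?_
        rw [abs_mul, abs_of_nonneg (ha i hi)]
        exact mul_le_mul_of_nonneg_left (abs_pow_le_mul_apply_abs hk (hg i) (hgM i) hx) (ha i hi)
    _ = M ^ (k - 1) * (∑ i ∈ s, a i • g i) |x| := by
        simp [Finset.mul_sum, mul_left_comm]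
    _ ≤ M ^ (k - 1) * ‖∑ i ∈ s, a i • g i‖ := by
        refine mul_le_mul_of_nonneg_left ((Real.le_norm_self _).trans ?_) (by positivity)
        exact ContinuousLinearMap.unit_le_opNorm _ _ (by rwa [norm_abs_eq_norm])

theorem weaklyNull_pow (hk : k ≠ 0) {g : ℕ → E →L[ℝ] ℝ} (hg : ∀ n y, 0 ≤ y → 0 ≤ g n y)
    (hw : WeaklyNull g) : WeaklyNull fun n => ofPos (isPosHomPoly_pow k (hg n)) := by
  obtain ⟨M, hgM⟩ := hw.exists_norm_le
  exact hw.of_norm_sum_smul_le fun s a ha =>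
    norm_sum_smul_pow_le hk hg ((norm_nonneg _).trans (hgM 0)) hgM ha

end RegPoly

end PowerPolynomials

section DiscreteZeroAtInfty

variable {α : Type*} [TopologicalSpace α]

theorem zeroAtInfty_norm_le {F : C₀(α, ℝ)} {C : ℝ} (hC : 0 ≤ C) (h : ∀ a, |F a| ≤ C) : ‖F‖ ≤ C :=
  (BoundedContinuousFunction.norm_le (f := F.toBCF) hC).2 h

theorem zeroAtInfty_abs_apply_le_norm (F : C₀(α, ℝ)) (a : α) : |F a| ≤ ‖F‖ :=
  F.toBCF.norm_coe_le_norm a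

theorem zeroAtInfty_sum_apply {ι : Type*} (s : Finset ι) (F : ι → C₀(α, ℝ)) (a : α) :
    (∑ i ∈ s, F i) a = ∑ i ∈ s, F i a := by
  classical
  induction s using Finset.induction_on with
  | empty => rfl
  | insert i s hi ih => rw [Finset.sum_insert hi, Finset.sum_insert hi, ← ih]; rfl

variable [DiscreteTopology α]

/-- A family of reals that vanishes at infinity on a discrete space, as an element of `C₀`. -/
def zeroAtInftyOfDiscrete (c : α → ℝ) (hc : Tendsto c cofinite (𝓝 0)) : C₀(α, ℝ) where
  toFun := c
  continuous_toFun := continuous_of_discreteTopology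
  zero_at_infty' := by rwa [cocompact_eq_cofinite]

@[simp]
theorem zeroAtInftyOfDiscrete_apply (c : α → ℝ) (hc : Tendsto c cofinite (𝓝 0)) (a : α) :
    zeroAtInftyOfDiscrete c hc a = c a := rfl

theorem finite_setOf_le_abs (F : C₀(α, ℝ)) {ε : ℝ} (hε : 0 < ε) : {a | ε ≤ |F a|}.Finite := by
  have hF : Tendsto F cofinite (𝓝 0) := cocompact_eq_cofinite α ▸ zero_at_infty F
  simpa [eventually_cofinite] using hF.abs.eventually_lt_const (u := ε) (by simpa using hε)

open Classical in
/-- The unit vectors of `C₀(α, ℝ)`. -/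
def unitVec (a : α) : C₀(α, ℝ) :=
  zeroAtInftyOfDiscrete (Pi.single a 1) <| tendsto_const_nhds.congr' <|
    mem_of_superset (Set.finite_singleton a).compl_mem_cofinite fun _ hb =>
      (Pi.single_eq_of_ne (M := fun _ => ℝ) hb 1).symm

open Classical in
theorem unitVec_apply (a b : α) : unitVec a b = if b = a then 1 else 0 := by
  simp [unitVec, Pi.single_apply]

theorem sum_smul_unitVec_apply (s : Finset α) (c : α → ℝ) (b : α) [Decidable (b ∈ s)] :
    (∑ a ∈ s, c a • unitVec a) b = if b ∈ s then c b else 0 := by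
  classical
  simp only [zeroAtInfty_sum_apply, ZeroAtInftyContinuousMap.smul_apply, unitVec_apply, smul_eq_mul,
    mul_ite, mul_one, mul_zero]
  convert Finset.sum_ite_eq s b c

theorem hasSum_smul_unitVec (F : C₀(α, ℝ)) : HasSum (fun a => F a • unitVec a) F := by
  classical
  rw [HasSum, SummationFilter.unconditional_filter, Metric.tendsto_atTop]
  intro ε hε
  refine ⟨(finite_setOf_le_abs F (half_pos hε)).toFinset, fun s hs => ?_⟩
  rw [dist_eq_norm]
  refine (zeroAtInfty_norm_le (half_pos hε).le fun a => ?_).trans_lt (half_lt_self hε)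
  rw [ZeroAtInftyContinuousMap.sub_apply, sum_smul_unitVec_apply]
  split_ifs with ha
  · simpa using (half_pos hε).le
  · have hFa : |F a| < ε / 2 := not_le.1 fun h => ha (hs (by simpa using h))
    simpa using hFa.le

theorem summable_abs_apply_unitVec (l : C₀(α, ℝ) →L[ℝ] ℝ) : Summable fun a => |l (unitVec a)| := by
  classical
  refine summable_of_sum_le (c := ‖l‖) (fun _ => abs_nonneg _) fun s => ?_
  have hsign : ‖∑ a ∈ s, (SignType.sign (l (unitVec a)) : ℝ) • unitVec a‖ ≤ 1 := by
    refine zeroAtInfty_norm_le zero_le_one fun a => ?_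
    rw [sum_smul_unitVec_apply]
    split_ifs
    · rcases SignType.trichotomy (SignType.sign (l (unitVec a))) with e | e | e <;> simp [e]
    · simp
  calc ∑ a ∈ s, |l (unitVec a)|
      = l (∑ a ∈ s, (SignType.sign (l (unitVec a)) : ℝ) • unitVec a) := by simp
    _ ≤ ‖l‖ := (Real.le_norm_self _).trans (l.unit_le_opNorm _ hsign)

theorem exists_apply_lt_of_isGLB_zero {D : Set C₀(α, ℝ)} (hD : IsGLB D 0) (a : α) {ε : ℝ}
    (hε : 0 < ε) : ∃ x ∈ D, x a < ε := by
  classical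
  by_contra! h
  have hlb : ε • unitVec a ∈ lowerBounds D := by
    intro x hx b
    change ε * unitVec a b ≤ x b
    rw [unitVec_apply, mul_ite, mul_one, mul_zero]
    split_ifs with hb
    · exact hb ▸ h x hx
    · exact hD.1 hx b
  have hle : ε * unitVec a a ≤ 0 := hD.2 hlb a
  rw [unitVec_apply, if_pos rfl, mul_one] at hle
  exact hle.not_gt hε

theorem orderContinuousNorm_zeroAtInfty : OrderContinuousNorm C₀(α, ℝ) := by
  classical
  rintro D ⟨x₀, hx₀⟩ hdir hglb ε hε
  choose y hyD hy using fun a => exists_apply_lt_of_isGLB_zero hglb a (half_pos hε)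
  have hfin := finite_setOf_le_abs x₀ (half_pos hε)
  have : Nonempty D := ⟨⟨x₀, hx₀⟩⟩
  obtain ⟨⟨x, hx⟩, hle⟩ := hdir.directed_val.finset_le
    (insert ⟨x₀, hx₀⟩ (hfin.toFinset.image fun a => ⟨y a, hyD a⟩))
  have hxx₀ : x ≤ x₀ := hle _ (Finset.mem_insert_self _ _)
  have hxy : ∀ a ∈ hfin.toFinset, x ≤ y a := fun a ha =>
    hle ⟨y a, hyD a⟩ (Finset.mem_insert_of_mem (Finset.mem_image.2 ⟨a, ha, rfl⟩))
  refine ⟨x, hx, (zeroAtInfty_norm_le (half_pos hε).le fun a => ?_).trans_lt (half_lt_self hε)⟩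
  rw [abs_of_nonneg (hglb.1 hx a)]
  by_cases ha : a ∈ hfin.toFinset
  · exact (hxy a ha a).trans (hy a).le
  · have hx₀a : |x₀ a| < ε / 2 := by simpa using ha
    exact (hxx₀ a).trans ((le_abs_self _).trans hx₀a.le)

end DiscreteZeroAtInfty

section EvalSequence

variable {α : Type*} [TopologicalSpace α] [DiscreteTopology α] (e : α ≃ ℕ)
  {V : Type*} [NormedAddCommGroup V] [NormedSpace ℝ V] {v : ℕ → V}

/-- The operator `φ ↦ (φ (v n))ₙ` from the dual of `V` to `c₀`, for a weakly null sequence `v`; the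
coordinates are indexed by a copy `α` of `ℕ`, so that the target can live in any universe. -/
def evalSequence (hv : WeaklyNull v) : (V →L[ℝ] ℝ) →L[ℝ] C₀(α, ℝ) :=
  LinearMap.mkContinuousOfExistsBound
    { toFun := fun φ => zeroAtInftyOfDiscrete (fun a => φ (v (e a)))
        ((hv φ).comp (Nat.cofinite_eq_atTop ▸ e.injective.tendsto_cofinite))
      map_add' := fun _ _ => rfl
      map_smul' := fun _ _ => rfl } <| by
    obtain ⟨M, hM⟩ := hv.exists_norm_le
    refine ⟨M, fun φ => zeroAtInfty_norm_le ?_ fun a => ?_⟩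
    · exact mul_nonneg ((norm_nonneg _).trans (hM 0)) (norm_nonneg φ)
    · exact (φ.le_of_opNorm_le_of_le le_rfl (hM (e a))).trans_eq (mul_comm _ _)

@[simp]
theorem evalSequence_apply (hv : WeaklyNull v) (φ : V →L[ℝ] ℝ) (a : α) :
    evalSequence e hv φ a = φ (v (e a)) := rfl

theorem continuousOn_apply_evalSequence (hv : WeaklyNull v) (l : C₀(α, ℝ) →L[ℝ] ℝ) (r : ℝ) :
    ContinuousOn (fun φ : WeakDual ℝ V => l (evalSequence e hv (WeakDual.toStrongDual φ)))
      (WeakDual.toStrongDual ⁻¹' Metric.closedBall 0 r) := by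
  obtain ⟨M, hM⟩ := hv.exists_norm_le
  have hsum : ∀ φ : WeakDual ℝ V, l (evalSequence e hv (WeakDual.toStrongDual φ)) =
      ∑' a, φ (v (e a)) * l (unitVec a) := fun φ => by
    have h := l.hasSum (hasSum_smul_unitVec (evalSequence e hv (WeakDual.toStrongDual φ)))
    simp only [map_smul, smul_eq_mul, evalSequence_apply] at h
    exact h.tsum_eq.symm
  simp only [hsum]
  refine continuousOn_tsum (u := fun a => r * M * |l (unitVec a)|) (fun a => ?_)
    ((summable_abs_apply_unitVec l).mul_left _) fun a φ hφ => ?_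
  · exact ((WeakDual.eval_continuous (v (e a))).mul_const _).continuousOn
  · rw [norm_mul]
    exact mul_le_mul_of_nonneg_right ((WeakDual.toStrongDual φ).le_of_opNorm_le_of_le
      (mem_closedBall_zero_iff.1 hφ) (hM _)) (norm_nonneg _)

theorem isCompact_image_evalSequence (hv : WeaklyNull v) (r : ℝ) :
    IsCompact (toWeakSpace ℝ C₀(α, ℝ) '' (evalSequence e hv '' Metric.closedBall 0 r)) := by
  set B := WeakDual.toStrongDual ⁻¹' Metric.closedBall (0 : StrongDual ℝ V) r
  have hcont : ContinuousOn (fun φ : WeakDual ℝ V =>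
      toWeakSpace ℝ C₀(α, ℝ) (evalSequence e hv (WeakDual.toStrongDual φ))) B := by
    rw [continuousOn_iff_continuous_domRestrict]
    exact WeakBilin.continuous_of_continuous_eval _ fun l =>
      continuousOn_iff_continuous_domRestrict.1 (continuousOn_apply_evalSequence e hv l r)
  convert! (WeakDual.isCompact_closedBall (0 : StrongDual ℝ V) r).image_of_continuousOn hcont
  rw [Set.image_image]
  ext z
  simp only [Set.mem_image]
  rfl

end EvalSequence

section PolynomialSequence

variable {α : Type*} [TopologicalSpace α] [DiscreteTopology α] (e : α ≃ ℕ) {k : ℕ} {E : Type*}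
  [NormedAddCommGroup E] [NormedSpace ℝ E] [Lattice E] [IsOrderedAddMonoid E] [HasSolidNorm E]
  {P : ℕ → RegPoly k E}

/-- The polynomial `x ↦ (P n x)ₙ` with values in `c₀`, for a weakly null sequence of polynomials. -/
def polySequence (hP : WeaklyNull P) (x : E) : C₀(α, ℝ) :=
  evalSequence e hP (RegPoly.evalForm k E fun _ => x)

theorem polySequence_apply (hP : WeaklyNull P) (x : E) (a : α) :
    polySequence e hP x a = P (e a) x :=
  (P (e a)).form_diagonal x

theorem isPosHomPoly_polySequence (hP : WeaklyNull P) (hP0 : ∀ n, 0 ≤ P n) :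
    IsPosHomPoly k (polySequence (α := α) e hP) := by
  refine ⟨(evalSequence e hP).compContinuousMultilinearMap (RegPoly.evalForm k E),
    fun σ v => ?_, fun v hv a => ?_, fun x => rfl⟩
  · ext a
    exact (P (e a)).form_perm σ v
  · simpa using RegPoly.form_le_form (hP0 (e a)) hv

theorem weaklyCompactMap_polySequence (hP : WeaklyNull P) :
    WeaklyCompactMap (polySequence (α := α) e hP) := by
  refine (isCompact_image_evalSequence e hP ‖RegPoly.evalForm k E‖).closure_of_subset
    (Set.image_mono ?_)
  rintro _ ⟨x, hx, rfl⟩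
  refine ⟨_, mem_closedBall_zero_iff.2 ?_, rfl⟩
  exact (RegPoly.evalForm k E).unit_le_opNorm
    ((pi_norm_le_iff_of_nonneg zero_le_one).2 fun _ => mem_closedBall_zero_iff.1 hx)

theorem tendsto_of_disjointPConvergent_polySequence {p : ℝ} (hP : WeaklyNull P)
    (H : DisjointPConvergent p (polySequence (α := α) e hP)) {x : ℕ → E} (hd : DisjointSeq x)
    (hx : WeaklyPSummable p x) : Tendsto (fun n => P n (x n)) atTop (𝓝 0) := by
  refine squeeze_zero_norm (fun n => ?_) (tendsto_zero_iff_norm_tendsto_zero.1 (H x hd hx))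
  simpa [polySequence_apply] using
    zeroAtInfty_abs_apply_le_norm (polySequence e hP (x n)) (e.symm n)

end PolynomialSequence

end

theorem theorem4p3_general (E : Type*) [NormedAddCommGroup E] [NormedSpace ℝ E]
    [Lattice E] [IsOrderedAddMonoid E] [HasSolidNorm E]
    (k : ℕ) (hk : 1 ≤ k) (p : ℝ) (hp : 0 < p) :
    List.TFAE [
      DisjointDPP p E,
      ∀ (F : Type*) [NormedAddCommGroup F] [NormedSpace ℝ F] [CompleteSpace F] [Lattice F]
        [IsOrderedAddMonoid F] [IsOrderedModule ℝ F] [HasSolidNorm F], OrderContinuousNorm F →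
        ∀ P : E → F, IsPosHomPoly k P → WeaklyCompactMap P → DisjointPConvergent p P,
      ∀ P : E → C₀(ℕ, ℝ), IsPosHomPoly k P → WeaklyCompactMap P → DisjointPConvergent p P,
      ∀ (x : ℕ → E) (P : ℕ → RegPoly k E), DisjointSeq x → WeaklyPSummable p x →
        (∀ n, 0 ≤ P n) → WeaklyNull P →
        Tendsto (fun n => P n (x n)) atTop (𝓝 0),
      ∀ (x : ℕ → E) (P : ℕ → RegPoly k E), DisjointSeq x → WeaklyPSummable p x →
        (∀ n, 0 ≤ P n) → RegPoly.DisjointSeq P → WeaklyNull P →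
        Tendsto (fun n => P n (x n)) atTop (𝓝 0),
      ∀ (x : ℕ → E) (P : ℕ → RegPoly k E), DisjointSeq x → WeaklyPSummable p x →
        RegPoly.DisjointSeq P → WeaklyNull P →
        Tendsto (fun n => P n (x n)) atTop (𝓝 0)] := by
  have hk0 : k ≠ 0 := Nat.one_le_iff_ne_zero.1 hk
  tfae_have 1 → 2 := fun hE F _ _ _ _ _ _ _ _ P hP hc => hE.disjointPConvergent hp hk hP hc
  tfae_have 1 → 3 := fun hE P hP hc => hE.disjointPConvergent hp hk hP hc
  tfae_have 1 → 6 := fun hE x P hd hx _ hP => hE.tendsto_regPoly hd hx hP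
  tfae_have 2 → 4 := fun h x P hd hx hP0 hP =>
    tendsto_of_disjointPConvergent_polySequence Equiv.ulift hP
      (h C₀(ULift ℕ, ℝ) orderContinuousNorm_zeroAtInfty _
        (isPosHomPoly_polySequence Equiv.ulift hP hP0)
        (weaklyCompactMap_polySequence Equiv.ulift hP)) hd hx
  tfae_have 3 → 4 := fun h x P hd hx hP0 hP =>
    tendsto_of_disjointPConvergent_polySequence (Equiv.refl ℕ) hP
      (h _ (isPosHomPoly_polySequence _ hP hP0) (weaklyCompactMap_polySequence _ hP)) hd hx
  tfae_have 4 → 5 := fun h x P hd hx hP0 _ hP => h x P hd hx hP0 hP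
  tfae_have 6 → 5 := fun h x P hd hx _ hPd hP => h x P hd hx hPd hP
  tfae_have 5 → 1 := fun h => disjointDPP_of_positive hp.le fun x g hd hx hx0 hg hw hgd =>
    tendsto_zero_of_pow (fun n => hg n _ (hx0 n)) hk0 <|
      h x (fun n => RegPoly.ofPos (isPosHomPoly_pow k (hg n))) hd hx
        (fun n => RegPoly.ofPos_nonneg _) (RegPoly.disjointSeq_pow hk0 hg hgd)
        (RegPoly.weaklyNull_pow hk0 hg hw)
  tfae_finish

theorem theorem4p3 (E : Type*) [NormedAddCommGroup E] [NormedSpace ℝ E] [CompleteSpace E]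
    [Lattice E] [IsOrderedAddMonoid E] [IsOrderedModule ℝ E] [HasSolidNorm E]
    (k : ℕ) (hk : 1 ≤ k) (p : ℝ) (hp : 1 ≤ p) :
    List.TFAE [
      DisjointDPP p E,
      ∀ (F : Type*) [NormedAddCommGroup F] [NormedSpace ℝ F] [CompleteSpace F] [Lattice F]
        [IsOrderedAddMonoid F] [IsOrderedModule ℝ F] [HasSolidNorm F], OrderContinuousNorm F →
        ∀ P : E → F, IsPosHomPoly k P → WeaklyCompactMap P → DisjointPConvergent p P,
      ∀ P : E → C₀(ℕ, ℝ), IsPosHomPoly k P → WeaklyCompactMap P → DisjointPConvergent p P,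
      ∀ (x : ℕ → E) (P : ℕ → RegPoly k E), DisjointSeq x → WeaklyPSummable p x →
        (∀ n, 0 ≤ P n) → WeaklyNull P →
        Tendsto (fun n => P n (x n)) atTop (𝓝 0),
      ∀ (x : ℕ → E) (P : ℕ → RegPoly k E), DisjointSeq x → WeaklyPSummable p x →
        (∀ n, 0 ≤ P n) → RegPoly.DisjointSeq P → WeaklyNull P →
        Tendsto (fun n => P n (x n)) atTop (𝓝 0),
      ∀ (x : ℕ → E) (P : ℕ → RegPoly k E), DisjointSeq x → WeaklyPSummable p x →
        RegPoly.DisjointSeq P → WeaklyNull P →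
        Tendsto (fun n => P n (x n)) atTop (𝓝 0)] :=
  theorem4p3_general E k hk p (zero_lt_one.trans_le hp)
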